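/- **Setting.** Let $\mathcal C=\mathbb Q[\hbar,\hbar^{-1}]$, let $\widehat{\mathfrak H^1}$ be the noncommutative polynomial ring over $\mathcal C$ in the variables $e_1$ and $g_k$ $(k\ge 1)$, and put $\mathcal A=\{e_1-g_1\}\sqcup\{g_k\mid k\ge 1\}$, which is a set of free generators. Let $\mathfrak z$ be the free $\mathcal C$-module spanned by $\mathcal A$, and let $\widehat{\mathfrak H^0}\subset\widehat{\mathfrak H^1}$ be the $\mathcal C$-submodule spanned by $1$ and the monomials $u_1\cdots u_r$ $(u_i\in\mathcal A)$ with $u_r\ne e_1-g_1$. Let $\circ_\hbar$ be the symmetric $\mathcal C$-bilinear product on $\mathfrak z$ with $$(e_1-g_1)\circ_\hbar(e_1-g_1)=\hbar(e_1-g_1),\quad (e_1-g_1)\circ_\hbar g_k=\hbar g_k,\quad g_k\circ_\hbar g_l=g_{k+l},$$ and write $u^{\circ_\hbar L}=u\circ_\hbar\cdots\circ_\hbar u$ ($L$ factors). The harmonic product $\ast_\hbar$ is the $\mathcal C$-bilinear product on $\widehat{\mathfrak H^1}$ determined by $w\ast_\hbar 1=1\ast_\hbar w=w$ and $$(wu)\ast_\hbar(w'v)=(w\ast_\hbar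 w'v)u+(wu\ast_\hbar w')v+(w\ast_\hbar w')(u\circ_\hbar v)\qquad(u,v\in\mathcal A).$$ It is extended coefficientwise to $\widehat{\mathfrak H^1}[[X]]$, and $\exp_{\ast_\hbar}(f)=1+\sum_{n\ge1}\frac1{n!}f^{\ast_\hbar n}$ for $f\in X\widehat{\mathfrak H^1}[[X]]$. For $k\ge1$ let $\phi_k=\sum_{j=1}^k (j-1)!\,{k\brace j}\hbar^{k-j}g_j$, where ${k\brace j}$ is the Stirling number of the second kind. For $P(z)=\sum_{n\ge1}c_nz^n\in\mathbb Q[z]$ let $\psi_P=\sum_{n\ge1}c_n(-\hbar)^{-n}g_n\in\mathfrak z$. Let $\epsilon_M=e^{2\pi i/M}$. **Theorem.** Let $P\in\mathbb Q[z]$ be nonzero with $P(0)=P(1)=0$, let $N=\deg P$, and let $L\ge1$. Then $N\ge2$. There is a power series $\alpha(x)$ with complex coefficients and positive radius of convergence such that $\alpha(0)=0$ and $$1-x^NP(z)=\prod_{m=1}^N\bigl(1-\alpha(\epsilon_N^m x)z\bigr)$$ for all $x$ in a neighborhood of $0$ and all $z$. For every such $\alpha$ and every $k\ge 2$, the series $\sum_{m=1}^{NL}\bigl(\mathrm{Log}(1-\alpha(\epsilon_{NL}^mX))\bigr)^k$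 has rational coefficients, and $$\frac1{1+(\psi_P)^{\circ_\hbar L}X^{NL}}=\exp_{\ast_\hbar}\Bigl(-\sum_{k\ge2}\frac{\hbar^{-k}}{k!}\,\phi_k\sum_{m=1}^{NL}\bigl(\mathrm{Log}(1-\alpha(\epsilon_{NL}^mX))\bigr)^k\Bigr),$$ where the left-hand side is the inverse with respect to the concatenation product. Both sides, and the argument of $\exp_{\ast_\hbar}$, are formal power series with coefficients in $\widehat{\mathfrak H^0}$. -/

import Mathlib

noncomputable section

namespace QMZV

open PowerSeries Finset

/-- The Laurent polynomial ring `ℚ[ħ, ħ⁻¹]`. The element `ħ ^ n` (`n : ℤ`) is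
`LaurentPolynomial.T n`. -/
abbrev Coef : Type := LaurentPolynomial ℚ

/-- The power `ħ ^ n`, `n : ℤ`. -/
abbrev hbar (n : ℤ) : Coef := LaurentPolynomial.T n

/-- The alphabet `{e₁ - g₁} ⊔ {g_k ∣ k ≥ 1}`; the letter `b` stands for `e₁ - g₁`. -/
inductive Letter : Type
  | b : Letter
  | g : ℕ+ → Letter

/-- The noncommutative polynomial ring over `ℚ[ħ, ħ⁻¹]` in the letters `e₁ - g₁`, `g_k` (`k ≥ 1`),
which is the same as that in the variables `e₁`, `g_k` (`k ≥ 1`). Its ring multiplication is the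
concatenation product. -/
abbrev H1 : Type := FreeAlgebra Coef Letter

/-- The free `ℚ[ħ, ħ⁻¹]`-module `𝔷` spanned by the alphabet. -/
abbrev Z : Type := Letter →₀ Coef

/-- The inclusion of `𝔷` into the noncommutative polynomial ring. -/
def Z.toH1 : Z →ₗ[Coef] H1 := Finsupp.linearCombination Coef (FreeAlgebra.ι Coef)

/-- The monomial `u₁ ⋯ u_r` of a word. -/
def word (w : List Letter) : H1 := (w.map (FreeAlgebra.ι Coef)).prod

/-- The submodule spanned by `1` and the monomials `u₁ ⋯ u_r` with `u_r ≠ e₁ - g₁`. -/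
def H0 : Submodule Coef H1 :=
  Submodule.span Coef {x | ∃ w : List Letter, w.getLast? ≠ some Letter.b ∧ x = word w}

/-- The product `u ∘ v` of two letters. -/
def circLetter : Letter → Letter → Z
  | .b, .b => Finsupp.single .b (hbar 1)
  | .b, .g k => Finsupp.single (.g k) (hbar 1)
  | .g k, .b => Finsupp.single (.g k) (hbar 1)
  | .g k, .g l => Finsupp.single (.g (k + l)) 1

/-- The bilinear product `∘` on `𝔷`. -/
def circ : Z →ₗ[Coef] Z →ₗ[Coef] Z :=
  Finsupp.linearCombination Coef fun a => Finsupp.linearCombination Coef (circLetter a)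

/-- The power `u ∘ u ∘ ⋯ ∘ u` (`n` factors) for `n ≥ 1`. The product `∘` has no unit; the value
at `n = 0` is a placeholder. -/
def circPow (u : Z) : ℕ → Z
  | 0 => 0
  | 1 => u
  | n + 2 => circ (circPow u (n + 1)) u

/-- The harmonic product of two words, both of which are given in reversed order
(the head of the list is the last letter of the word):
`(wu) ∗ (w'v) = (w ∗ w'v)u + (wu ∗ w')v + (w ∗ w')(u ∘ v)`. -/
def harmWord : List Letter → List Letter → H1
  | [], w' => word w'.reverse
  | u :: w, [] => word (u :: w).reverse
  | u :: w, v :: w' =>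
      harmWord w (v :: w') * FreeAlgebra.ι Coef u + harmWord (u :: w) w' * FreeAlgebra.ι Coef v
        + harmWord w w' * Z.toH1 (circLetter u v)
  termination_by w w' => w.length + w'.length

/-- The harmonic product: the bilinear extension of the harmonic product of words. -/
def harm : H1 →ₗ[Coef] H1 →ₗ[Coef] H1 :=
  (FreeAlgebra.basisFreeMonoid Coef Letter).constr Coef fun w =>
    (FreeAlgebra.basisFreeMonoid Coef Letter).constr Coef fun w' =>
      harmWord w.toList.reverse w'.toList.reverse

theorem basis_ofList (w : List Letter) :
    FreeAlgebra.basisFreeMonoid Coef Letter (FreeMonoid.ofList w) = word w := by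
  simp [FreeAlgebra.basisFreeMonoid, word, FreeAlgebra.equivMonoidAlgebraFreeMonoid,
    MonoidAlgebra.coeffLinearEquiv, FreeMonoid.lift_apply]

theorem harm_word (w w' : List Letter) :
    harm (word w) (word w') = harmWord w.reverse w'.reverse := by
  rw [← basis_ofList, ← basis_ofList]
  simp [harm, Module.Basis.constr_basis]

/-- The words span. -/
theorem span_word : Submodule.span Coef (Set.range word) = ⊤ := by
  have h : Set.range word = Set.range (FreeAlgebra.basisFreeMonoid Coef Letter) := by
    ext x
    constructor
    · rintro ⟨w, rfl⟩
      exact ⟨FreeMonoid.ofList w, basis_ofList w⟩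
    · rintro ⟨w, rfl⟩
      exact ⟨FreeMonoid.toList w, (basis_ofList _).symm⟩
  rw [h, Module.Basis.span_eq]

theorem word_nil : word [] = 1 := rfl

theorem word_concat (w : List Letter) (u : Letter) :
    word (w ++ [u]) = word w * FreeAlgebra.ι Coef u := by
  simp [word]

theorem word_induction {p : H1 → Prop} (w : H1) (hword : ∀ l, p (word l))
    (hadd : ∀ x y, p x → p y → p (x + y)) (hsmul : ∀ (c : Coef) x, p x → p (c • x)) : p w := by
  have hw : w ∈ Submodule.span Coef (Set.range word) := by rw [span_word]; trivial
  induction hw using Submodule.span_induction with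
  | mem x hx => obtain ⟨l, rfl⟩ := hx; exact hword l
  | zero => simpa using hsmul 0 _ (hword [])
  | add x y _ _ hx hy => exact hadd x y hx hy
  | smul c x _ hx => exact hsmul c x hx

/-- The first defining property of the harmonic product. -/
theorem harm_one (w : H1) : harm w 1 = w := by
  induction w using word_induction with
  | hword l =>
    rw [← word_nil, harm_word]
    generalize hl : l.reverse = l'
    obtain rfl : l = l'.reverse := by simp [← hl]
    cases l' <;> simp [harmWord]
  | hadd x y hx hy => simp [hx, hy]
  | hsmul c x hx => simp [hx]

theorem one_harm (w : H1) : harm 1 w = w := by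
  induction w using word_induction with
  | hword l => rw [← word_nil, harm_word]; simp [harmWord]
  | hadd x y hx hy => simp [hx, hy]
  | hsmul c x hx => simp [hx]

/-- The second defining property of the harmonic product. -/
theorem harm_mul_letter (w w' : H1) (u v : Letter) :
    harm (w * FreeAlgebra.ι Coef u) (w' * FreeAlgebra.ι Coef v) =
      harm w (w' * FreeAlgebra.ι Coef v) * FreeAlgebra.ι Coef u
        + harm (w * FreeAlgebra.ι Coef u) w' * FreeAlgebra.ι Coef v
        + harm w w' * Z.toH1 (circLetter u v) := by
  induction w using word_induction with
  | hword l =>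
    induction w' using word_induction with
    | hword l' =>
      rw [← word_concat, ← word_concat]
      simp only [harm_word, List.reverse_append, List.reverse_cons, List.reverse_nil,
        List.nil_append, List.singleton_append]
      rw [harmWord]
    | hadd x y hx hy =>
      simp only [add_mul, map_add, hx, hy]
      abel
    | hsmul c x hx => simp only [smul_mul_assoc, map_smul, hx, smul_add]
  | hadd x y hx hy =>
    simp only [add_mul, map_add, LinearMap.add_apply, hx, hy]
    abel
  | hsmul c x hx => simp only [smul_mul_assoc, map_smul, LinearMap.smul_apply, hx, smul_add]

/-- The harmonic product of formal power series. -/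
def harmMul (f g : H1⟦X⟧) : H1⟦X⟧ :=
  PowerSeries.mk fun n => ∑ p ∈ antidiagonal n, harm (coeff p.1 f) (coeff p.2 g)

/-- The powers of a formal power series with respect to the harmonic product. -/
def harmPow (f : H1⟦X⟧) : ℕ → H1⟦X⟧
  | 0 => 1
  | n + 1 => harmMul (harmPow f n) f

/-- A scalar rational number times `ħ ^ n`. -/
def ratHbar (c : ℚ) (n : ℤ) : Coef := LaurentPolynomial.C c * hbar n

/-- The exponential `1 + ∑_{n ≥ 1} f^{∗ n} / n!` with respect to the harmonic product, for a series
`f` without constant term. Only the powers with `n ≤ d` contribute to the coefficient of `X ^ d`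
(see `coeff_harmPow`). -/
def expHarm (f : H1⟦X⟧) : H1⟦X⟧ :=
  PowerSeries.mk fun d =>
    ∑ n ∈ range (d + 1), ratHbar (1 / (n.factorial : ℚ)) 0 • coeff d (harmPow f n)

theorem coeff_harmPow (f : H1⟦X⟧) (hf : constantCoeff f = 0) (n d : ℕ) (h : d < n) :
    coeff d (harmPow f n) = 0 := by
  induction n generalizing d with
  | zero => omega
  | succ n ih =>
    rw [harmPow, harmMul, coeff_mk]
    refine sum_eq_zero fun p hp => ?_
    rw [HasAntidiagonal.mem_antidiagonal] at hp
    by_cases h2 : p.2 = 0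
    · rw [h2, coeff_zero_eq_constantCoeff_apply, hf, map_zero]
    · rw [ih p.1 (by omega), map_zero, LinearMap.zero_apply]

/-- The element `g_n` of `𝔷` for `n ≥ 1` (with `0` for the index `n = 0`, which is never used). -/
def gZ (n : ℕ) : Z := if h : 0 < n then Finsupp.single (Letter.g ⟨n, h⟩) 1 else 0

/-- `φ_k = ∑_{j=1}^k (j-1)! {k brace j} ħ^{k-j} g_j`, with the Stirling numbers of the second
kind. -/
def phi (k : ℕ) : Z :=
  ∑ j ∈ Icc 1 k,
    ratHbar ((j - 1).factorial * Nat.stirlingSecond k j : ℕ) ((k : ℤ) - j) • gZ j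

/-- `ψ_P = ∑_{n ≥ 1} c_n (-ħ)^{-n} g_n` for `P = ∑_{n ≥ 1} c_n z^n`. -/
def psi (P : Polynomial ℚ) : Z :=
  P.sum fun n c => ratHbar (c * (-1) ^ n) (-(n : ℤ)) • gZ n

/-- The series `1 / (1 + u X^d)`, for `d ≥ 1`, in the ring of formal power series, with respect to
the concatenation product. The inverse exists by `isUnit_one_add_monomial`. -/
def geom (u : Z) (d : ℕ) : H1⟦X⟧ := Ring.inverse (1 + PowerSeries.monomial d (Z.toH1 u))

theorem isUnit_one_add_monomial (u : H1) (d : ℕ) (hd : 1 ≤ d) :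
    IsUnit (1 + PowerSeries.monomial d u) := by
  apply MvPowerSeries.isUnit_iff_constantCoeff.2
  change IsUnit (constantCoeff (1 + PowerSeries.monomial d u))
  have h : constantCoeff (PowerSeries.monomial d u) = 0 := by
    rw [← coeff_zero_eq_constantCoeff_apply, coeff_monomial, if_neg (by omega)]
  simp [h]

/-- The root of unity `ε_N = exp(2πi/N)`. -/
def eps (N : ℕ) : ℂ := Complex.exp (2 * Real.pi * Complex.I / N)

/-- The value of a power series at a point (where it converges). -/
def value (α : ℂ⟦X⟧) (x : ℂ) : ℂ := ∑' n : ℕ, coeff n α * x ^ n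

/-- `α` is a convergent power series (its radius of convergence is positive) with `α(0) = 0` and
`1 - x^N P(z) = ∏_{m=1}^N (1 - α(ε_N^m x) z)` for `x` in a neighborhood of `0`, where
`N = deg P`. -/
structure IsRootSeries (P : Polynomial ℚ) (α : ℂ⟦X⟧) : Prop where
  constantCoeff_eq : constantCoeff α = 0
  convergent : 0 < (FormalMultilinearSeries.ofScalars ℂ fun n => coeff n α).radius
  factor : ∀ᶠ x in nhds (0 : ℂ), ∀ z : ℂ,
    1 - x ^ P.natDegree * Polynomial.aeval z P =
      ∏ m ∈ Icc 1 P.natDegree, (1 - value α (eps P.natDegree ^ m * x) * z)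

/-- The power series `∑_{m=1}^M (Log (1 - α(ε_M^m X)))^k`. -/
def logSum (α : ℂ⟦X⟧) (M k : ℕ) : ℂ⟦X⟧ :=
  ∑ m ∈ Icc 1 M, logOf (1 - rescale (eps M ^ m) α) ^ k

theorem coeff_logSum (α : ℂ⟦X⟧) (hα : constantCoeff α = 0) (M k n : ℕ) (h : n < k) :
    coeff n (logSum α M k) = 0 := by
  rw [logSum, map_sum]
  refine sum_eq_zero fun m _ => ?_
  have h0 : constantCoeff (logOf (1 - rescale (eps M ^ m) α)) = 0 := by
    apply constantCoeff_logOf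
    rw [map_sub, ← coeff_zero_eq_constantCoeff_apply (rescale _ _), coeff_rescale,
      coeff_zero_eq_constantCoeff_apply, hα]
    simp
  exact X_pow_dvd_iff.1 (pow_dvd_pow_of_dvd (X_dvd_iff.2 h0) k) n h

/-- The series `-∑_{k ≥ 2} (ħ^{-k} φ_k / k!) S_k(X)` for power series `S_k(X)` of order at least
`k`. Only the terms with `k ≤ n` contribute to the coefficient of `X ^ n`. -/
def exponent (S : ℕ → ℚ⟦X⟧) : H1⟦X⟧ :=
  PowerSeries.mk fun n =>
    -∑ k ∈ Icc 2 n, ratHbar (coeff n (S k) / (k.factorial : ℚ)) (-(k : ℤ)) • Z.toH1 (phi k)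

end QMZV

end

noncomputable section

namespace QMZV

open PowerSeries Finset

/-! The identity splits into one about the two products and one about power series in commuting
variables.

Products: for every `u` in `𝔷` and `d ≥ 1`, `1/(1 + u X^d) = exp_∗(log_∘(1 - u X^d))`
(`geom_eq_expHarm`). With `θ = X d/dX`, both sides have constant term 1 and solve `θG = G ∗ θa`,
where `a = log_∘(1 - u X^d)`; such a solution is unique (`eq_expHarm`). For the geometric series the
equation amounts to `∑_j (-1)^j u^{n-j} ∗ u^{∘(j+1)} = (n+1) u^{n+1}`, which telescopes, because
`u^{m+1} ∗ a` is the sum of all insertions of `a` into `u^{m+1}` and of `u ∘ a` into `u^m`.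

Power series: `P ↦ ψ_P` turns products in `zℚ[z]` into `∘` (`psi_mul`), so `log_∘(1 - ψ_P^{∘L}
X^{NL})` is the image of `log(1 - P^L X^{NL})`. Since `(e^t - 1)^j` generates the Stirling numbers,
`ħ^{-k} φ_k / k!` is the image of the `t^k`-coefficient of `-log(1 + z(e^t - 1))`. Putting `t =
Log(1 - α)` gives `-log(1 - αz)`, and summing over the rotations of `α` gives `-log(1 - P^L X^{NL})`
by the factorization defining `α`. In coefficients: Newton's identities give `N [X^{Nj}] α^n = n
[z^n] P^j / j` (`IsRootSeries.coeff_pow`), which also yields rationality, and the Stirling sum is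
inverted by `exp(log(1 + X)) = 1 + X`. The term `k = 1` drops out because `P(1) = 0`.

The series `α` comes from inverting `w ↦ w q(w)^{-1/N}` near 0, where `q` is the reversed polynomial
of `P`. -/

/-! ### Harmonic products with elements of `𝔷` -/

theorem toH1_single (u : Letter) (c : Coef) :
    Z.toH1 (Finsupp.single u c) = c • FreeAlgebra.ι Coef u := by
  simp [Z.toH1]

theorem circ_single (u v : Letter) (c e : Coef) :
    circ (Finsupp.single u c) (Finsupp.single v e) = (c * e) • circLetter u v := by
  simp [circ, mul_smul]

theorem circLetter_comm (u v : Letter) : circLetter u v = circLetter v u := by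
  cases u <;> cases v <;> simp [circLetter, add_comm]

theorem circ_comm (x y : Z) : circ x y = circ y x := by
  induction x using Finsupp.induction_linear with
  | zero => simp
  | add x x' hx hx' => simp [hx, hx']
  | single u c =>
    induction y using Finsupp.induction_linear with
    | zero => simp
    | add y y' hy hy' => simp [hy, hy']
    | single v e => rw [circ_single, circ_single, circLetter_comm, mul_comm]

/-- Given commutativity, this is associativity of `∘`, in the form needed for commuting two harmonic
multiplications. -/
theorem circ_right_comm (x y z : Z) : circ (circ x y) z = circ (circ x z) y := by
  induction x using Finsupp.induction_linear with
  | zero => simp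
  | add x x' hx hx' => simp [hx, hx']
  | single u c =>
    induction y using Finsupp.induction_linear with
    | zero => simp
    | add y y' hy hy' => simp [hy, hy']
    | single v e =>
      induction z using Finsupp.induction_linear with
      | zero => simp
      | add z z' hz hz' => simp [hz, hz']
      | single w f =>
        rw [circ_single, circ_single, map_smul, map_smul, LinearMap.smul_apply,
          LinearMap.smul_apply]
        cases u <;> cases v <;> cases w <;>
          simp only [circLetter, circ_single, Finsupp.smul_single, smul_eq_mul, mul_one, one_mul] <;>
          congr 1 <;> first | ring | (congr 1; simp only [add_comm, add_left_comm])

theorem harm_mul_toH1 (w : H1) (x a : Z) :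
    harm (w * Z.toH1 x) (Z.toH1 a) =
      harm w (Z.toH1 a) * Z.toH1 x + w * Z.toH1 x * Z.toH1 a + w * Z.toH1 (circ x a) := by
  induction x using Finsupp.induction_linear with
  | zero => simp
  | add x x' hx hx' =>
    simp only [map_add, mul_add, add_mul, LinearMap.add_apply, hx, hx']
    abel
  | single u c =>
    induction a using Finsupp.induction_linear with
    | zero => simp
    | add y y' hy hy' =>
      simp only [map_add, mul_add, add_mul, hy, hy']
      abel
    | single v e =>
      have h := harm_mul_letter w 1 u v
      rw [one_mul, harm_one, harm_one] at h
      rw [circ_single]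
      simp only [toH1_single, map_smul, mul_smul_comm, smul_mul_assoc, LinearMap.smul_apply, h,
        smul_add, mul_smul]
      simp only [smul_comm c e]

/-- Harmonic multiplications by elements of `𝔷` commute. -/
theorem harm_toH1_right_comm (w : H1) (a b : Z) :
    harm (harm w (Z.toH1 a)) (Z.toH1 b) = harm (harm w (Z.toH1 b)) (Z.toH1 a) := by
  induction w using word_induction with
  | hadd x y hx hy => simp only [map_add, LinearMap.add_apply, hx, hy]
  | hsmul c x hx => simp only [map_smul, LinearMap.smul_apply, hx]
  | hword l =>
    induction l using List.reverseRecOn with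
    | nil =>
      have ha := harm_mul_toH1 1 a b
      have hb := harm_mul_toH1 1 b a
      simp only [one_mul, one_harm] at ha hb
      rw [word_nil, one_harm, one_harm, ha, hb, circ_comm b a]
      abel
    | append_singleton l u ih =>
      have hu : FreeAlgebra.ι Coef u = Z.toH1 (Finsupp.single u 1) := by simp [toH1_single]
      rw [word_concat, hu]
      generalize Finsupp.single u (1 : Coef) = x
      simp only [harm_mul_toH1, map_add, LinearMap.add_apply, mul_assoc]
      simp only [← mul_assoc, harm_mul_toH1, add_mul, ih, circ_comm b a, circ_right_comm x b a]
      abel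

/-- Quasi-shuffling one element into a power either inserts it in a gap or merges it with one of the
factors. -/
theorem harm_pow_toH1 (u a : Z) (m : ℕ) :
    harm (Z.toH1 u ^ (m + 1)) (Z.toH1 a) =
      ∑ i ∈ range (m + 2), Z.toH1 u ^ i * Z.toH1 a * Z.toH1 u ^ (m + 1 - i) +
        ∑ i ∈ range (m + 1), Z.toH1 u ^ i * Z.toH1 (circ u a) * Z.toH1 u ^ (m - i) := by
  have key (b : Z) (m : ℕ) :
      ∑ i ∈ range (m + 2), Z.toH1 u ^ i * Z.toH1 b * Z.toH1 u ^ (m + 1 - i) =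
        (∑ i ∈ range (m + 1), Z.toH1 u ^ i * Z.toH1 b * Z.toH1 u ^ (m - i)) * Z.toH1 u +
          Z.toH1 u ^ (m + 1) * Z.toH1 b := by
    rw [sum_range_succ, sum_mul]
    congr 1
    · refine sum_congr rfl fun i hi => ?_
      rw [mem_range] at hi
      rw [mul_assoc _ _ (Z.toH1 u), ← pow_succ]
      congr 2
      omega
    · simp
  induction m with
  | zero =>
    have h := harm_mul_toH1 1 u a
    simp only [one_mul, one_harm] at h
    simp [h, sum_range_succ]
  | succ m ih =>
    rw [pow_succ, harm_mul_toH1, ih, key a (m + 1), key (circ u a) m, add_mul, pow_succ _ (m + 1)]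
    abel

theorem neg_smul_H1 (c : Coef) (x : H1) : (-c) • x = -(c • x) := by
  rw [eq_neg_iff_add_eq_zero, ← add_smul, neg_add_cancel, zero_smul]

/-- By `harm_pow_toH1`, each term is an insertion sum for `(u ∘)^j a` plus one for `(u ∘)^{j+1} a`;
the signs make the sum telescope to the insertions of `a`. -/
theorem alternating_sum_harm_pow (u a : Z) (n : ℕ) :
    ∑ j ∈ range (n + 1),
        (-1 : Coef) ^ j • harm (Z.toH1 u ^ (n - j)) (Z.toH1 ((circ u)^[j] a)) =
      ∑ i ∈ range (n + 1), Z.toH1 u ^ i * Z.toH1 a * Z.toH1 u ^ (n - i) := by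
  induction n generalizing a with
  | zero => simp [one_harm]
  | succ n ih =>
    rw [sum_range_succ']
    have h := ih (circ u a)
    simp only [Nat.add_sub_add_right, Function.iterate_succ_apply, pow_succ, mul_neg_one,
      neg_smul_H1, sum_neg_distrib] at h ⊢
    rw [h, Nat.sub_zero, harm_pow_toH1, pow_zero, one_smul, Function.iterate_zero_apply]
    abel

theorem iterate_circ_self (u : Z) (j : ℕ) : (circ u)^[j] u = circPow u (j + 1) := by
  induction j with
  | zero => rfl
  | succ j ih => rw [Function.iterate_succ_apply', ih, circPow, circ_comm]

theorem alternating_sum_harm_circPow (u : Z) (n : ℕ) :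
    ∑ j ∈ range (n + 1),
        (-1 : Coef) ^ j • harm (Z.toH1 u ^ (n - j)) (Z.toH1 (circPow u (j + 1))) =
      (n + 1) • Z.toH1 u ^ (n + 1) := by
  simp only [← iterate_circ_self]
  rw [alternating_sum_harm_pow]
  rw [sum_congr rfl (g := fun _ => Z.toH1 u ^ (n + 1)), sum_const, card_range]
  intro i hi
  rw [mem_range] at hi
  rw [← pow_succ, ← pow_add]
  congr 1
  omega

/-! ### The harmonic exponential and its differential equation -/

/-- The power series with coefficients in `𝔷`, as a power series over `H1`. -/
def letterSeries (a : ℕ → Z) : H1⟦X⟧ := PowerSeries.mk fun n => Z.toH1 (a n)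

theorem coeff_letterSeries (a : ℕ → Z) (n : ℕ) : coeff n (letterSeries a) = Z.toH1 (a n) :=
  coeff_mk _ _

theorem harmMul_letterSeries_right_comm (h : H1⟦X⟧) (a b : ℕ → Z) :
    harmMul (harmMul h (letterSeries a)) (letterSeries b) =
      harmMul (harmMul h (letterSeries b)) (letterSeries a) := by
  ext n
  simp only [harmMul, coeff_mk, coeff_letterSeries, map_sum, LinearMap.sum_apply]
  rw [sum_sigma', sum_sigma']
  refine sum_nbij' (fun s => ⟨(s.2.1 + s.1.2, s.2.2), (s.2.1, s.1.2)⟩)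
    (fun s => ⟨(s.2.1 + s.1.2, s.2.2), (s.2.1, s.1.2)⟩) ?_ ?_ ?_ ?_ ?_
  · rintro ⟨⟨p, q⟩, ⟨r, s⟩⟩ h
    simp only [mem_sigma, HasAntidiagonal.mem_antidiagonal, and_true] at h ⊢
    omega
  · rintro ⟨⟨p, q⟩, ⟨r, s⟩⟩ h
    simp only [mem_sigma, HasAntidiagonal.mem_antidiagonal, and_true] at h ⊢
    omega
  · rintro ⟨⟨p, q⟩, ⟨r, s⟩⟩ h
    simp only [mem_sigma, HasAntidiagonal.mem_antidiagonal] at h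
    obtain ⟨-, rfl⟩ := h
    rfl
  · rintro ⟨⟨p, q⟩, ⟨r, s⟩⟩ h
    simp only [mem_sigma, HasAntidiagonal.mem_antidiagonal] at h
    obtain ⟨-, rfl⟩ := h
    rfl
  · rintro ⟨⟨p, q⟩, ⟨r, s⟩⟩ -
    exact harm_toH1_right_comm _ _ _

theorem harmMul_nsmul (k : ℕ) (f g : H1⟦X⟧) : harmMul (k • f) g = k • harmMul f g := by
  ext n
  simp only [harmMul, coeff_mk, map_nsmul, smul_sum, LinearMap.smul_apply]

/-- The derivation `X d/dX`. -/
def euler (f : H1⟦X⟧) : H1⟦X⟧ := PowerSeries.mk fun n => n • coeff n f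

theorem euler_harmMul (f g : H1⟦X⟧) :
    euler (harmMul f g) = harmMul (euler f) g + harmMul f (euler g) := by
  ext n
  simp only [euler, harmMul, coeff_mk, map_add, smul_sum]
  rw [← sum_add_distrib]
  refine sum_congr rfl fun p hp => ?_
  rw [HasAntidiagonal.mem_antidiagonal] at hp
  rw [← hp, add_smul, map_nsmul, map_nsmul, LinearMap.smul_apply]

theorem euler_letterSeries (a : ℕ → Z) :
    euler (letterSeries a) = letterSeries fun n => n • a n := by
  ext n
  simp [euler, letterSeries]

/-- The power rule needs only that harmonic multiplications by series over `𝔷` commute with each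
other, not general associativity or commutativity of `∗`. -/
theorem euler_harmPow (a : ℕ → Z) (k : ℕ) :
    euler (harmPow (letterSeries a) (k + 1)) =
      (k + 1) • harmMul (harmPow (letterSeries a) k) (euler (letterSeries a)) := by
  induction k with
  | zero =>
    rw [zero_add, one_smul, show harmPow (letterSeries a) 1 =
      harmMul (harmPow (letterSeries a) 0) (letterSeries a) from rfl, euler_harmMul]
    have h : euler (harmPow (letterSeries a) 0) = 0 := by
      ext n
      rcases n with _ | n <;> simp [euler, harmPow, coeff_one]
    have h0 : harmMul 0 (letterSeries a) = 0 := by simpa using harmMul_nsmul 0 0 (letterSeries a)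
    rw [h, h0, zero_add]
  | succ k ih =>
    rw [harmPow, euler_harmMul, ih, harmMul_nsmul, euler_letterSeries,
      harmMul_letterSeries_right_comm, ← harmPow, succ_nsmul (n := k + 1)]

theorem ratHbar_zero_mul (c e : ℚ) : ratHbar c 0 * ratHbar e 0 = ratHbar (c * e) 0 := by
  simp [ratHbar]

theorem nsmul_eq_ratHbar_smul {M : Type*} [AddCommGroup M] [Module Coef M] (n : ℕ) (x : M) :
    n • x = ratHbar n 0 • x := by
  rw [← Nat.cast_smul_eq_nsmul Coef]
  simp [ratHbar]

theorem nsmul_cancel {n : ℕ} (hn : n ≠ 0) {x y : H1} (h : n • x = n • y) : x = y := by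
  have h2 := congrArg (fun z => ratHbar ((n : ℚ)⁻¹) 0 • z) h
  have hn' : (n : ℚ) ≠ 0 := by exact_mod_cast hn
  have h1 : ratHbar 1 0 = 1 := by simp [ratHbar]
  simpa only [nsmul_eq_ratHbar_smul, smul_smul, ratHbar_zero_mul, inv_mul_cancel₀ hn', h1,
    one_smul] using h2

theorem euler_expHarm (a : ℕ → Z) (ha : a 0 = 0) :
    euler (expHarm (letterSeries a)) =
      harmMul (expHarm (letterSeries a)) (euler (letterSeries a)) := by
  have h0 : constantCoeff (letterSeries a) = 0 := by
    rw [← coeff_zero_eq_constantCoeff_apply, coeff_letterSeries, ha, map_zero]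
  ext n
  have hk (k : ℕ) : n • (ratHbar (1 / ((k + 1).factorial : ℚ)) 0 •
        coeff n (harmPow (letterSeries a) (k + 1))) =
      ratHbar (1 / (k.factorial : ℚ)) 0 •
        coeff n (harmMul (harmPow (letterSeries a) k) (euler (letterSeries a))) := by
    have h := congrArg (coeff n) (euler_harmPow a k)
    rw [euler, coeff_mk, map_nsmul] at h
    rw [smul_comm, h, nsmul_eq_ratHbar_smul, smul_smul, ratHbar_zero_mul]
    congr 2
    rw [Nat.factorial_succ]
    have : (k.factorial : ℚ) ≠ 0 := by exact_mod_cast k.factorial_ne_zero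
    have : ((k + 1 : ℕ) : ℚ) ≠ 0 := by exact_mod_cast k.succ_ne_zero
    push_cast at *
    field_simp
  rw [euler, coeff_mk, expHarm, coeff_mk, smul_sum, sum_range_succ', sum_congr rfl fun k _ => hk k]
  have hz : n • (ratHbar (1 / ((0 : ℕ).factorial : ℚ)) 0 •
      coeff n (harmPow (letterSeries a) 0)) = 0 := by
    rcases n with _ | n <;> simp [harmPow, coeff_one]
  rw [hz, add_zero]
  simp only [harmMul, coeff_mk, smul_sum]
  rw [sum_comm]
  refine sum_congr rfl fun p hp => ?_
  rw [HasAntidiagonal.mem_antidiagonal] at hp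
  rcases Nat.eq_zero_or_pos p.2 with h2 | h2
  · simp [h2, euler]
  · rw [map_sum, LinearMap.sum_apply]
    simp only [map_smul, LinearMap.smul_apply]
    symm
    -- The truncations differ: `expHarm` uses powers up to `p.1` here and up to `n - 1` on the other
    -- side. The extra powers have order above `p.1`.
    refine sum_subset (range_subset_range.2 (by omega)) fun k _ hk => ?_
    rw [mem_range, not_lt] at hk
    rw [coeff_harmPow _ h0 _ _ (by omega)]
    simp

theorem coeff_zero_expHarm (f : H1⟦X⟧) : coeff 0 (expHarm f) = 1 := by
  simp [expHarm, harmPow, ratHbar]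

/-- The harmonic exponential is characterized by its logarithmic derivative. -/
theorem eq_expHarm (a : ℕ → Z) (ha : a 0 = 0) (G : H1⟦X⟧) (hG0 : coeff 0 G = 1)
    (hG : euler G = harmMul G (euler (letterSeries a))) : G = expHarm (letterSeries a) := by
  have hE := euler_expHarm a ha
  ext n
  induction n using Nat.strong_induction_on with
  | _ n ih =>
    rcases Nat.eq_zero_or_pos n with rfl | hn
    · rw [hG0, coeff_zero_expHarm]
    apply nsmul_cancel hn.ne'
    have h1 := congrArg (coeff n) hG
    have h2 := congrArg (coeff n) hE
    rw [euler, coeff_mk] at h1 h2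
    rw [h1, h2]
    simp only [harmMul, coeff_mk]
    refine sum_congr rfl fun p hp => ?_
    rw [HasAntidiagonal.mem_antidiagonal] at hp
    -- `θa` has no constant term, so only coefficients of `G` below `n` enter.
    rcases Nat.eq_zero_or_pos p.2 with h2 | h2
    · simp [h2, euler]
    · rw [ih p.1 (by omega)]

/-! ### The geometric series as a harmonic exponential -/

theorem sum_antidiagonal_of_dvd {M : Type*} [AddCommMonoid M] (d : ℕ) (hd : 1 ≤ d)
    (A : ℕ → ℕ → M) (hA : ∀ i j, ¬ (d ∣ i ∧ d ∣ j) → A i j = 0) (k : ℕ) :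
    ∑ p ∈ antidiagonal (d * k), A p.1 p.2 = ∑ p ∈ antidiagonal k, A (d * p.1) (d * p.2) := by
  symm
  refine sum_of_injOn (fun p => (d * p.1, d * p.2)) ?_ ?_ ?_ fun _ _ => rfl
  · rintro ⟨i, j⟩ - ⟨i', j'⟩ - h
    simp only [Prod.mk.injEq] at h
    rw [Nat.eq_of_mul_eq_mul_left hd h.1, Nat.eq_of_mul_eq_mul_left hd h.2]
  · rintro ⟨i, j⟩ h
    simp only [mem_coe, HasAntidiagonal.mem_antidiagonal] at h ⊢
    rw [← mul_add, h]
  · rintro ⟨i, j⟩ h h'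
    refine hA i j ?_
    rintro ⟨⟨i, rfl⟩, ⟨j, rfl⟩⟩
    refine h' ⟨(i, j), ?_, rfl⟩
    simp only [mem_coe, HasAntidiagonal.mem_antidiagonal] at h ⊢
    rw [← mul_add] at h
    exact Nat.eq_of_mul_eq_mul_left hd h

/-- The coefficients of `log_∘ (1 - u X ^ d)`. -/
def circLogCoeff (u : Z) (d n : ℕ) : Z :=
  if d ∣ n then -(ratHbar (1 / ((n / d : ℕ) : ℚ)) 0 • circPow u (n / d)) else 0

theorem nsmul_circLogCoeff (u : Z) (d : ℕ) (hd : 1 ≤ d) (k : ℕ) :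
    (d * k) • circLogCoeff u d (d * k) = -(d • circPow u k) := by
  rw [circLogCoeff, if_pos (dvd_mul_right d k), Nat.mul_div_cancel_left k hd, mul_smul, smul_neg,
    nsmul_eq_ratHbar_smul k, smul_smul, ratHbar_zero_mul, smul_neg]
  rcases Nat.eq_zero_or_pos k with rfl | hk
  · simp [circPow]
  · have : (k : ℚ) ≠ 0 := by exact_mod_cast hk.ne'
    rw [mul_one_div_cancel this]
    simp [ratHbar]

theorem geom_eq (u : Z) (d : ℕ) (hd : 1 ≤ d) :
    geom u d = PowerSeries.mk fun n =>
      if d ∣ n then (-1 : Coef) ^ (n / d) • Z.toH1 u ^ (n / d) else 0 := by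
  have h := isUnit_one_add_monomial (Z.toH1 u) d hd
  refine h.mul_left_cancel ?_
  rw [geom, Ring.mul_inverse_cancel _ h]
  ext n
  rw [add_mul, one_mul, map_add, coeff_mk, monomial_eq_C_mul_X_pow, mul_assoc, coeff_C_mul,
    coeff_X_pow_mul']
  simp only [coeff_mk, coeff_one]
  rcases Nat.eq_zero_or_pos n with rfl | hn
  · simp [show ¬ d ≤ 0 by omega]
  rw [if_neg hn.ne']
  by_cases hdn : d ∣ n
  · obtain ⟨k, rfl⟩ := hdn
    obtain ⟨k, rfl⟩ := Nat.exists_eq_succ_of_ne_zero (show k ≠ 0 by rintro rfl; simp at hn)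
    have : d * k.succ - d = d * k := by rw [Nat.mul_succ]; omega
    rw [if_pos (Nat.le_mul_of_pos_right _ k.succ_pos), this, if_pos (dvd_mul_right _ _),
      if_pos (dvd_mul_right _ _), Nat.mul_div_cancel_left _ hd, Nat.mul_div_cancel_left _ hd,
      pow_succ, pow_succ', mul_neg_one, neg_smul_H1, mul_smul_comm]
    simp
  · rw [if_neg hdn, zero_add]
    split_ifs with h1 h2
    · exact absurd ((Nat.dvd_sub_iff_left h1 dvd_rfl).1 h2) hdn
    · simp
    · simp

/-- `1 / (1 + u X ^ d) = exp_∗ (log_∘ (1 - u X ^ d))`. -/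
theorem geom_eq_expHarm (u : Z) (d : ℕ) (hd : 1 ≤ d) :
    geom u d = expHarm (letterSeries (circLogCoeff u d)) := by
  refine eq_expHarm _ (by simp [circLogCoeff, circPow]) _ (by rw [geom_eq u d hd]; simp) ?_
  rw [geom_eq u d hd, euler_letterSeries]
  ext n
  simp only [euler, harmMul, coeff_mk, coeff_letterSeries]
  by_cases hdn : d ∣ n
  · obtain ⟨k, rfl⟩ := hdn
    rw [sum_antidiagonal_of_dvd d hd (fun i j => harm
      (if d ∣ i then (-1 : Coef) ^ (i / d) • Z.toH1 u ^ (i / d) else 0)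
      (Z.toH1 (j • circLogCoeff u d j)))]
    · simp only [dvd_mul_right, if_true, nsmul_circLogCoeff u d hd, Nat.mul_div_cancel_left _ hd,
        map_neg, map_nsmul, map_smul, LinearMap.smul_apply]
      rcases k with _ | k
      · simp [circPow]
      have h := alternating_sum_harm_circPow u k
      rw [Nat.sum_antidiagonal_succ', ← Nat.sum_antidiagonal_swap,
        Nat.sum_antidiagonal_eq_sum_range_succ_mk]
      simp only [circPow, map_zero, smul_zero, neg_zero, zero_add, Prod.swap]
      rw [mul_smul, smul_comm (k + 1), ← h, smul_sum, smul_sum]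
      refine sum_congr rfl fun j hj => ?_
      rw [mem_range] at hj
      obtain ⟨m, rfl⟩ := Nat.exists_eq_add_of_le (Nat.lt_succ_iff.1 hj)
      rw [Nat.add_sub_cancel_left]
      have hs : (-1 : Coef) ^ (j + m + 1) * (-1) ^ j = -(-1) ^ m := by
        rw [← pow_add, show j + m + 1 + j = 2 * j + (m + 1) by ring, pow_add, pow_mul]
        simp [pow_succ]
      rw [smul_smul, hs, neg_smul, smul_neg, smul_comm]
    · intro i j hij
      by_cases hi : d ∣ i
      · have hj : ¬ d ∣ j := fun hj => hij ⟨hi, hj⟩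
        simp [circLogCoeff, hj]
      · simp [hi]
  · rw [if_neg hdn, smul_zero]
    symm
    refine sum_eq_zero fun p hp => ?_
    rw [HasAntidiagonal.mem_antidiagonal] at hp
    by_cases hi : d ∣ p.1
    · have hj : ¬ d ∣ p.2 := fun hj => hdn (hp ▸ dvd_add hi hj)
      simp [circLogCoeff, hj]
    · simp [hi]

/-! ### The map `ψ` and the elements `φ_k` -/

theorem ratHbar_mul (a b : ℚ) (m n : ℤ) :
    ratHbar a m * ratHbar b n = ratHbar (a * b) (m + n) := by
  simp only [ratHbar, hbar, LaurentPolynomial.T_add, map_mul]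
  ring

theorem ratHbar_add (a b : ℚ) (m : ℤ) : ratHbar (a + b) m = ratHbar a m + ratHbar b m := by
  simp only [ratHbar, map_add, add_mul]

theorem ratHbar_zero (m : ℤ) : ratHbar 0 m = 0 := by simp [ratHbar]

theorem ratHbar_sum {ι : Type*} (s : Finset ι) (a : ι → ℚ) (m : ℤ) :
    ratHbar (∑ i ∈ s, a i) m = ∑ i ∈ s, ratHbar (a i) m := by
  simp only [ratHbar, map_sum, sum_mul]

theorem psi_monomial (n : ℕ) (c : ℚ) :
    psi (Polynomial.monomial n c) = ratHbar (c * (-1) ^ n) (-(n : ℤ)) • gZ n := by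
  rw [psi, Polynomial.sum_monomial_index]
  simp [ratHbar_zero]

theorem psi_add (P Q : Polynomial ℚ) : psi (P + Q) = psi P + psi Q := by
  rw [psi, Polynomial.sum_add_index]
  · rfl
  · simp [ratHbar_zero]
  · intro n a b
    rw [add_mul, ratHbar_add, add_smul]

theorem psi_zero : psi 0 = 0 := by simp [psi]

theorem psi_sum {ι : Type*} (s : Finset ι) (P : ι → Polynomial ℚ) :
    psi (∑ i ∈ s, P i) = ∑ i ∈ s, psi (P i) := by
  induction s using Finset.cons_induction with
  | empty => simp [psi_zero]
  | cons i s hi ih => rw [sum_cons, sum_cons, psi_add, ih]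

theorem psi_C_mul (c : ℚ) (P : Polynomial ℚ) :
    psi (Polynomial.C c * P) = ratHbar c 0 • psi P := by
  induction P using Polynomial.induction_on' with
  | add P Q hP hQ => rw [mul_add, psi_add, psi_add, hP, hQ, smul_add]
  | monomial n a =>
    rw [Polynomial.C_mul_monomial, psi_monomial, psi_monomial, smul_smul, ratHbar_mul, zero_add,
      mul_assoc]

theorem circ_gZ (m n : ℕ) : circ (gZ (m + 1)) (gZ (n + 1)) = gZ (m + n + 2) := by
  rw [gZ, dif_pos m.succ_pos, gZ, dif_pos n.succ_pos, gZ, dif_pos (Nat.succ_pos _), circ_single,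
    one_mul, one_smul]
  change Finsupp.single _ _ = _
  congr 2
  apply PNat.eq
  change m + 1 + (n + 1) = m + n + 2
  ring

/-- `ψ` is multiplicative on polynomials without constant term. -/
theorem psi_mul (P Q : Polynomial ℚ) (hP : Polynomial.X ∣ P) (hQ : Polynomial.X ∣ Q) :
    psi (P * Q) = circ (psi P) (psi Q) := by
  obtain ⟨P, rfl⟩ := hP
  obtain ⟨Q, rfl⟩ := hQ
  induction P using Polynomial.induction_on' with
  | add P P' hP hP' =>
    rw [mul_add, add_mul, psi_add, psi_add, hP, hP', map_add, LinearMap.add_apply]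
  | monomial m a =>
    induction Q using Polynomial.induction_on' with
    | add Q Q' hQ hQ' => rw [mul_add, mul_add, psi_add, psi_add, hQ, hQ', map_add]
    | monomial n b =>
      rw [Polynomial.X_mul_monomial, Polynomial.X_mul_monomial, Polynomial.monomial_mul_monomial,
        psi_monomial, psi_monomial, psi_monomial, map_smul, map_smul, LinearMap.smul_apply,
        circ_gZ, smul_smul, ratHbar_mul, show m + 1 + (n + 1) = m + n + 2 by ring]
      congr 2
      · ring
      · push_cast
        ring

theorem circPow_succ (u : Z) {n : ℕ} (hn : 1 ≤ n) :
    circPow u (n + 1) = circ (circPow u n) u := by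
  obtain ⟨n, rfl⟩ := Nat.exists_eq_add_of_le' hn
  rfl

theorem circPow_psi (P : Polynomial ℚ) (hP : Polynomial.X ∣ P) {n : ℕ} (hn : 1 ≤ n) :
    circPow (psi P) n = psi (P ^ n) := by
  induction n, hn using Nat.le_induction with
  | base => rw [pow_one, circPow]
  | succ n hn ih =>
    rw [circPow_succ _ hn, ih, pow_succ, psi_mul _ _ (dvd_pow hP (by omega)) hP]

theorem circLogCoeff_psi (P : Polynomial ℚ) (hP : Polynomial.X ∣ P) {L d : ℕ} (hL : 1 ≤ L)
    (hd : 1 ≤ d) (j : ℕ) :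
    circLogCoeff (circPow (psi P) L) d (d * j) =
      -psi (Polynomial.C (1 / (j : ℚ)) * P ^ (L * j)) := by
  rw [circLogCoeff, if_pos (dvd_mul_right d j), Nat.mul_div_cancel_left j hd, circPow_psi P hP hL,
    psi_C_mul]
  rcases Nat.eq_zero_or_pos j with rfl | hj
  -- For `j = 0` both sides vanish because `1 / 0 = 0`.
  · simp [ratHbar_zero]
  · rw [circPow_psi _ (dvd_pow hP (by omega)) hj, pow_mul]

/-- The powers of `ħ` combine to `ħ^{-i}` on `g_i`, which is the weight used by `ψ`. Hence the sum
lies in the image of `ψ`, and the comparison becomes one of rational polynomials; the sign `(-1)^i`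
offsets the one inside `ψ`. -/
theorem sum_smul_phi (n : ℕ) (s : ℕ → ℚ) :
    ∑ k ∈ Icc 1 n, ratHbar (s k / k.factorial) (-(k : ℤ)) • phi k =
      psi (∑ i ∈ Icc 1 n, Polynomial.monomial i
        ((i - 1).factorial * (-1) ^ i *
          ∑ k ∈ Icc 1 n, Nat.stirlingSecond k i * s k / k.factorial)) := by
  have h (k : ℕ) (hk : k ∈ Icc 1 n) : ratHbar (s k / k.factorial) (-(k : ℤ)) • phi k =
      ∑ i ∈ Icc 1 n, ratHbar ((i - 1).factorial * Nat.stirlingSecond k i * (s k / k.factorial))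
        (-(i : ℤ)) • gZ i := by
    rw [phi, smul_sum]
    rw [mem_Icc] at hk
    refine (sum_congr rfl fun i _ => ?_).trans
      (sum_subset (Icc_subset_Icc_right hk.2) fun i _ hi => ?_)
    · rw [smul_smul, ratHbar_mul]
      congr 2
      · push_cast
        ring
      · ring
    · rw [mem_Icc] at *
      rw [Nat.stirlingSecond_eq_zero_of_lt (by omega)]
      simp [ratHbar_zero]
  rw [sum_congr rfl h, sum_comm, psi_sum]
  refine sum_congr rfl fun i _ => ?_
  rw [psi_monomial, ← sum_smul, ← ratHbar_sum]
  congr 2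
  have h1 : ((-1 : ℚ) ^ i) * (-1) ^ i = 1 := by rw [← mul_pow]; simp
  rw [mul_right_comm, mul_assoc _ ((-1 : ℚ) ^ i) ((-1) ^ i), h1, mul_one, mul_sum]
  refine sum_congr rfl fun k _ => ?_
  ring

/-! ### Membership in the submodule `H0` -/

theorem mul_gZ_mem_H0 (x : H1) (n : ℕ) : x * Z.toH1 (gZ n) ∈ H0 := by
  rw [gZ]
  split_ifs with h
  · induction x using word_induction with
    | hword l =>
      rw [toH1_single, one_smul, ← word_concat]
      exact Submodule.subset_span ⟨_, by simp, rfl⟩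
    | hadd x y hx hy => rw [add_mul]; exact H0.add_mem hx hy
    | hsmul c x hx => rw [smul_mul_assoc]; exact H0.smul_mem _ hx
  · simp

theorem one_mem_H0 : (1 : H1) ∈ H0 := Submodule.subset_span ⟨[], by simp, rfl⟩

theorem mul_psi_mem_H0 (x : H1) (P : Polynomial ℚ) : x * Z.toH1 (psi P) ∈ H0 := by
  rw [psi, Polynomial.sum, map_sum, mul_sum]
  refine H0.sum_mem fun n _ => ?_
  rw [map_smul, mul_smul_comm]
  exact H0.smul_mem _ (mul_gZ_mem_H0 _ _)

theorem coeff_geom_psi_mem_H0 (P : Polynomial ℚ) (hP : Polynomial.X ∣ P) {L d : ℕ} (hL : 1 ≤ L)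
    (hd : 1 ≤ d) (n : ℕ) : coeff n (geom (circPow (psi P) L) d) ∈ H0 := by
  rw [geom_eq _ d hd, coeff_mk, circPow_psi P hP hL]
  split_ifs
  · refine H0.smul_mem _ ?_
    cases n / d with
    | zero => exact one_mem_H0
    | succ k => rw [pow_succ]; exact mul_psi_mem_H0 _ _
  · exact H0.zero_mem

theorem toH1_phi_mem_H0 (k : ℕ) : Z.toH1 (phi k) ∈ H0 := by
  rw [phi, map_sum]
  refine H0.sum_mem fun j _ => ?_
  rw [map_smul, ← one_mul (Z.toH1 (gZ j))]
  exact H0.smul_mem _ (mul_gZ_mem_H0 _ _)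

theorem coeff_exponent_mem_H0 (S : ℕ → ℚ⟦X⟧) (n : ℕ) : coeff n (exponent S) ∈ H0 := by
  rw [exponent, coeff_mk]
  exact H0.neg_mem (H0.sum_mem fun k _ => H0.smul_mem _ (toH1_phi_mem_H0 k))

/-! ### Formal power series: Newton's identities, Stirling numbers, exp and log -/

theorem coeff_pow_eq_zero {R : Type*} [CommRing R] {b : R⟦X⟧} (hb : constantCoeff b = 0)
    {n k : ℕ} (h : n < k) : coeff n (b ^ k) = 0 :=
  X_pow_dvd_iff.1 (pow_dvd_pow_of_dvd (X_dvd_iff.2 hb) k) n h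

theorem coeff_subst_eq_sum {R : Type*} [CommRing R] (f b : R⟦X⟧) (hb : constantCoeff b = 0)
    {n m : ℕ} (h : n ≤ m) :
    coeff n (f.subst b) = ∑ k ∈ range (m + 1), coeff k f * coeff n (b ^ k) := by
  rw [coeff_subst' (HasSubst.of_constantCoeff_zero' hb)]
  refine finsum_eq_sum_of_support_subset _ fun k hk => ?_
  rw [mem_coe, mem_range]
  by_contra hkm
  exact hk (by simp [coeff_pow_eq_zero hb (show n < k by omega)])

/-- Logarithmic derivative of the product, with `1/(1 - cX)` written as a geometric series. -/
theorem derivative_prod_one_sub {ι : Type*} (s : Finset ι) (a : ι → ℂ) :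
    (∏ i ∈ s, (1 - C (a i) * X)) * ∑ i ∈ s, C (a i) * PowerSeries.mk (fun n => a i ^ n) =
      -d⁄dX ℂ (∏ i ∈ s, (1 - C (a i) * X)) := by
  have hgeom (c : ℂ) : (1 - C c * X) * PowerSeries.mk (fun n => c ^ n) = 1 := by
    ext n
    rw [sub_mul, one_mul, map_sub, coeff_mk, mul_assoc, coeff_C_mul]
    rcases n with _ | n
    · simp
    · simp [coeff_succ_X_mul, coeff_one, pow_succ']
  induction s using Finset.cons_induction with
  | empty => simp
  | cons i s hi ih =>
    rw [prod_cons, sum_cons, Derivation.leibniz, smul_eq_mul, smul_eq_mul]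
    have hd : d⁄dX ℂ (1 - C (a i) * X) = -C (a i) := by
      rw [map_sub, derivative_one, Derivation.leibniz, derivative_C, derivative_X]
      simp
    rw [hd]
    linear_combination (1 - C (a i) * X) * ih +
      (∏ i ∈ s, (1 - C (a i) * X)) * C (a i) * hgeom (a i)

/-- Newton's identities in logarithmic form. -/
theorem sum_pow_eq_of_one_sub_eq_prod {ι : Type*} (s : Finset ι) (a : ι → ℂ) (W : ℂ⟦X⟧)
    (hW : constantCoeff W = 0) (h : 1 - W = ∏ i ∈ s, (1 - C (a i) * X)) {n : ℕ} (hn : 1 ≤ n) :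
    ∑ i ∈ s, a i ^ n = n * ∑ j ∈ Icc 1 n, coeff n (W ^ j) / j := by
  obtain ⟨n, rfl⟩ := Nat.exists_eq_add_of_le' hn
  have h1 := derivative_prod_one_sub s a
  rw [← h, map_sub, derivative_one, zero_sub, neg_neg] at h1
  set A := ∑ i ∈ s, C (a i) * PowerSeries.mk (fun n => a i ^ n) with hA
  -- `B` truncates `W'/(1 - W)`, which equals `A`; the tail is divisible by `X^{n+1}`, so the
  -- coefficients at `n` agree.
  set B : ℂ⟦X⟧ := ∑ j ∈ range (n + 1), W ^ j * d⁄dX ℂ W with hB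
  have h2 : (1 - W) * B = d⁄dX ℂ W - W ^ (n + 1) * d⁄dX ℂ W := by
    have := mul_neg_geom_sum W (n + 1)
    rw [hB, ← sum_mul, ← mul_assoc, this, sub_mul, one_mul]
  have h3 : (1 - W) * (A - B) = W ^ (n + 1) * d⁄dX ℂ W := by
    rw [mul_sub, h1, h2]
    ring
  have hu : IsUnit (1 - W) := by
    rw [isUnit_iff_constantCoeff]
    simp [hW]
  have h4 : X ^ (n + 1) ∣ A - B := by
    rw [← hu.dvd_mul_left, h3]
    exact (pow_dvd_pow_of_dvd (X_dvd_iff.2 hW) _).mul_right _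
  have h5 := X_pow_dvd_iff.1 h4 n n.lt_succ_self
  rw [map_sub, sub_eq_zero] at h5
  have hAn : coeff n A = ∑ i ∈ s, a i ^ (n + 1) := by
    simp [hA, coeff_C_mul, pow_succ']
  rw [← hAn, h5, hB, map_sum, mul_sum]
  refine sum_nbij' (· + 1) (· - 1) (fun j hj => ?_) (fun j hj => ?_) (fun j _ => rfl)
    (fun j hj => ?_) fun j _ => ?_
  · simp only [mem_range, mem_Icc] at *
    omega
  · simp only [mem_range, mem_Icc] at *
    omega
  · simp only [mem_Icc] at hj
    omega
  · have h6 := congrArg (coeff n) (derivative_pow W (j + 1))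
    rw [Nat.add_sub_cancel, coeff_derivative, mul_assoc, ← nsmul_eq_mul, map_nsmul,
      nsmul_eq_mul] at h6
    have hj : ((j + 1 : ℕ) : ℂ) ≠ 0 := by exact_mod_cast j.succ_ne_zero
    rw [← mul_right_inj' hj, ← h6]
    push_cast at hj ⊢
    field_simp

/-- Differentiating `(e^t - 1)^{i+1}` reproduces the recurrence of the Stirling numbers. -/
theorem coeff_exp_sub_one_pow (n i : ℕ) :
    coeff n ((exp ℚ - 1) ^ i) = (i.factorial : ℚ) * Nat.stirlingSecond n i / n.factorial := by
  induction n generalizing i with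
  | zero => rcases i with _ | i <;> simp [Nat.stirlingSecond_zero_succ]
  | succ n ih =>
    rcases i with _ | i
    · simp [coeff_one]
    have h : d⁄dX ℚ ((exp ℚ - 1) ^ (i + 1)) =
        (i + 1 : ℕ) • ((exp ℚ - 1) ^ (i + 1) + (exp ℚ - 1) ^ i) := by
      rw [derivative_pow, map_sub, derivative_exp, derivative_one, nsmul_eq_mul,
        Nat.add_sub_cancel]
      ring
    have h2 := congrArg (coeff n) h
    rw [coeff_derivative, map_nsmul, map_add, ih, ih, nsmul_eq_mul] at h2
    have hn : ((n + 1 : ℕ) : ℚ) ≠ 0 := by exact_mod_cast n.succ_ne_zero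
    have hf : (n.factorial : ℚ) ≠ 0 := by exact_mod_cast n.factorial_ne_zero
    rw [Nat.stirlingSecond_succ_succ]
    push_cast [Nat.factorial_succ] at h2 hn ⊢
    field_simp at h2 ⊢
    linear_combination h2

/-- With `D = log' = 1/(1 + X)`, one has `D' = -D²`, so `exp(log) · D` has derivative zero and
constant term 1. -/
theorem exp_subst_log : (exp ℚ).subst (log ℚ) = 1 + X := by
  have hlog : (1 + X) * d⁄dX ℚ (log ℚ) = 1 := by
    rw [deriv_log]
    ext n
    rw [add_mul, one_mul, map_add, coeff_mk]
    rcases n with _ | n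
    · simp
    · simp [coeff_succ_X_mul, coeff_one, pow_succ]
  have hlog2 : d⁄dX ℚ (log ℚ) * d⁄dX ℚ (log ℚ) + d⁄dX ℚ (d⁄dX ℚ (log ℚ)) = 0 := by
    have h := congrArg (d⁄dX ℚ) hlog
    rw [Derivation.leibniz, map_add, derivative_one, derivative_X, smul_eq_mul, smul_eq_mul] at h
    linear_combination d⁄dX ℚ (log ℚ) * h - d⁄dX ℚ (d⁄dX ℚ (log ℚ)) * hlog
  have h : (exp ℚ).subst (log ℚ) * d⁄dX ℚ (log ℚ) = 1 := by
    apply derivative.ext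
    · rw [Derivation.leibniz, derivative_subst HasSubst.log, derivative_exp, derivative_one,
        smul_eq_mul, smul_eq_mul]
      linear_combination (exp ℚ).subst (log ℚ) * hlog2
    · rw [map_mul, ← coeff_zero_eq_constantCoeff_apply, ← coeff_zero_eq_constantCoeff_apply,
        coeff_subst_eq_sum _ _ constantCoeff_log le_rfl, deriv_log]
      simp
  linear_combination (1 + X) * h - (exp ℚ).subst (log ℚ) * hlog

/-- Coefficient form of `(exp(log(1 + X)) - 1)^i = X^i`. -/
theorem sum_stirlingSecond_mul_coeff_log_pow (i : ℕ) {n m : ℕ} (h : n ≤ m) :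
    ∑ k ∈ range (m + 1), i.factorial * Nat.stirlingSecond k i / k.factorial *
      coeff n (log ℚ ^ k) = if n = i then 1 else 0 := by
  have h1 : ((exp ℚ - 1) ^ i).subst (log ℚ) = X ^ i := by
    have h1 : (1 : ℚ⟦X⟧).subst (log ℚ) = 1 := by
      rw [← coe_substAlgHom HasSubst.log, map_one]
    rw [subst_pow HasSubst.log, subst_sub HasSubst.log, exp_subst_log, h1, add_sub_cancel_left]
  have h2 := coeff_subst_eq_sum ((exp ℚ - 1) ^ i) (log ℚ) constantCoeff_log h
  rw [h1, coeff_X_pow] at h2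
  rw [h2]
  exact sum_congr rfl fun k _ => by rw [coeff_exp_sub_one_pow]

theorem coeff_logOf_one_sub_pow (β : ℂ⟦X⟧) (hβ : constantCoeff β = 0) (k d : ℕ) :
    coeff d (logOf (1 - β) ^ k) = ∑ n ∈ range (d + 1),
      ((coeff n (log ℚ ^ k) * (-1) ^ n : ℚ) : ℂ) * coeff d (β ^ n) := by
  have hb : constantCoeff (-β) = 0 := by simp [hβ]
  rw [logOf_eq, sub_sub_cancel_left, ← subst_pow (HasSubst.of_constantCoeff_zero' hb),
    coeff_subst_eq_sum _ _ hb le_rfl]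
  refine sum_congr rfl fun n _ => ?_
  rw [← map_log (algebraMap ℚ ℂ), ← map_pow, coeff_map, neg_pow, ← map_one (C (R := ℂ)),
    ← map_neg, ← map_pow, coeff_C_mul]
  simp [mul_assoc]

/-! ### Convergent power series and the identity theorem -/

/-- The power series `p` converges to `f` near `0`. -/
def Represents (f : ℂ → ℂ) (p : ℂ⟦X⟧) : Prop :=
  ∀ᶠ x in nhds (0 : ℂ), HasSum (fun n => coeff n p * x ^ n) (f x)

namespace Represents

variable {f g : ℂ → ℂ} {p q : ℂ⟦X⟧}

theorem mul (hf : Represents f p) (hg : Represents g q) :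
    Represents (fun x => f x * g x) (p * q) := by
  filter_upwards [hf, hg] with x hx hy
  have h := hasSum_sum_range_mul_of_summable_norm hx.summable.norm hy.summable.norm
  rw [hx.tsum_eq, hy.tsum_eq] at h
  have hc (n : ℕ) : coeff n (p * q) * x ^ n =
      ∑ k ∈ range (n + 1), coeff k p * x ^ k * (coeff (n - k) q * x ^ (n - k)) := ?_
  · simp only [hc]
    exact h
  rw [coeff_mul, sum_mul, Nat.sum_antidiagonal_eq_sum_range_succ_mk]
  refine sum_congr rfl fun i hi => ?_
  rw [mem_range, Nat.lt_succ_iff] at hi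
  rw [mul_mul_mul_comm, ← pow_add, Nat.add_sub_cancel' hi]

theorem monomial (n : ℕ) (c : ℂ) :
    Represents (fun x => c * x ^ n) (PowerSeries.monomial n c) := by
  refine Filter.Eventually.of_forall fun x => ?_
  have h := hasSum_single (f := fun m => coeff m (PowerSeries.monomial n c) * x ^ m) n
    fun m hm => by rw [coeff_monomial, if_neg hm, zero_mul]
  simpa using h

theorem pow (hf : Represents f p) (n : ℕ) : Represents (fun x => f x ^ n) (p ^ n) := by
  induction n with
  | zero => simpa using monomial 0 1
  | succ n ih => simpa only [pow_succ] using ih.mul hf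

theorem sum {ι : Type*} (s : Finset ι) {F : ι → ℂ → ℂ} {r : ι → ℂ⟦X⟧}
    (h : ∀ i ∈ s, Represents (F i) (r i)) :
    Represents (fun x => ∑ i ∈ s, F i x) (∑ i ∈ s, r i) := by
  have h' := (Filter.eventually_all_finset s).2 h
  filter_upwards [h'] with x hx
  simpa only [map_sum, sum_mul] using hasSum_sum hx

theorem rescale (hf : Represents f p) (c : ℂ) :
    Represents (fun x => f (c * x)) (PowerSeries.rescale c p) := by
  have hc : Filter.Tendsto (fun x : ℂ => c * x) (nhds 0) (nhds 0) := by
    have : Continuous fun x : ℂ => c * x := by fun_prop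
    simpa using this.tendsto 0
  filter_upwards [hc.eventually hf] with x hx
  convert hx using 2 with n
  rw [coeff_rescale, mul_pow]
  ring

theorem hasFPowerSeriesAt (hf : Represents f p) :
    HasFPowerSeriesAt f (FormalMultilinearSeries.ofScalars ℂ fun n => coeff n p) 0 := by
  rw [hasFPowerSeriesAt_iff]
  filter_upwards [hf] with x hx
  simpa [FormalMultilinearSeries.coeff_ofScalars, mul_comm] using hx

theorem unique (hf : Represents f p) (hg : Represents g q) (h : ∀ᶠ x in nhds 0, f x = g x) :
    p = q := by
  have h1 := (hf.hasFPowerSeriesAt.congr h).eq_formalMultilinearSeries hg.hasFPowerSeriesAt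
  ext n
  exact congrFun (FormalMultilinearSeries.ofScalars_series_injective ℂ ℂ h1) n

end Represents

/-! ### Coefficients of the powers of `α` -/

variable {P : Polynomial ℚ} {α : ℂ⟦X⟧}

theorem IsRootSeries.represents (h : IsRootSeries P α) : Represents (value α) α := by
  have h1 := (FormalMultilinearSeries.hasFPowerSeriesOnBall _ h.convergent).hasFPowerSeriesAt
  rw [hasFPowerSeriesAt_iff] at h1
  filter_upwards [h1] with x hx
  simp only [FormalMultilinearSeries.coeff_ofScalars, smul_eq_mul, mul_comm (x ^ _)] at hx
  exact hx.summable.hasSum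

theorem eps_pow_self {M : ℕ} (hM : M ≠ 0) : eps M ^ M = 1 :=
  (Complex.isPrimitiveRoot_exp M hM).pow_eq_one

/-- For fixed small `x`, the factorization is an identity of polynomials in `z`, to which Newton's
identities apply with `W = x^N P(z)`. -/
theorem IsRootSeries.sum_value_pow (h : IsRootSeries P α) (hP : Polynomial.X ∣ P) {n : ℕ}
    (hn : 1 ≤ n) : ∀ᶠ x in nhds (0 : ℂ),
    ∑ m ∈ Icc 1 P.natDegree, value α (eps P.natDegree ^ m * x) ^ n =
      ∑ j ∈ Icc 1 n, n * ((P ^ j).coeff n : ℂ) / j * x ^ (P.natDegree * j) := by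
  filter_upwards [h.factor] with x hx
  set PC : Polynomial ℂ := P.map (algebraMap ℚ ℂ) with hPC
  set W : Polynomial ℂ := Polynomial.C (x ^ P.natDegree) * PC with hWdef
  have hpoly : 1 - W = ∏ m ∈ Icc 1 P.natDegree,
      (1 - Polynomial.C (value α (eps P.natDegree ^ m * x)) * Polynomial.X) := by
    apply Polynomial.funext
    intro z
    have := hx z
    simp only [Polynomial.eval_prod, Polynomial.eval_sub, Polynomial.eval_mul, Polynomial.eval_one,
      Polynomial.eval_C, Polynomial.eval_X, hWdef, hPC, Polynomial.eval_map_algebraMap]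
    exact this
  have hser := congrArg (Polynomial.coeToPowerSeries.ringHom (R := ℂ)) hpoly
  rw [map_sub, map_one, map_prod] at hser
  simp only [map_sub, map_one, map_mul, Polynomial.coeToPowerSeries.ringHom_apply,
    Polynomial.coe_C, Polynomial.coe_X] at hser
  have hW0 : constantCoeff (W : ℂ⟦X⟧) = 0 := by
    have h0 : P.coeff 0 = 0 := Polynomial.X_dvd_iff.1 hP
    rw [Polynomial.constantCoeff_coe, hWdef, Polynomial.coeff_C_mul, hPC, Polynomial.coeff_map, h0,
      map_zero, mul_zero]
  rw [sum_pow_eq_of_one_sub_eq_prod _ _ _ hW0 hser hn, mul_sum]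
  refine sum_congr rfl fun j _ => ?_
  rw [← Polynomial.coe_pow, Polynomial.coeff_coe, hWdef, mul_pow, ← Polynomial.C_pow,
    Polynomial.coeff_C_mul, hPC, ← Polynomial.map_pow, Polynomial.coeff_map, ← pow_mul]
  simp only [eq_ratCast]
  ring

/-- Both sides of the power sum identity are convergent series in `x`. At the exponent `Nj` every
rotation acts trivially, whence the factor `N`. -/
theorem IsRootSeries.coeff_pow (h : IsRootSeries P α) (hP : Polynomial.X ∣ P)
    (hN : P.natDegree ≠ 0) {n : ℕ} (hn : 1 ≤ n) (j : ℕ) :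
    P.natDegree * coeff (P.natDegree * j) (α ^ n) = n * ((P ^ j).coeff n : ℂ) / j := by
  have hl : Represents (fun x => ∑ m ∈ Icc 1 P.natDegree, value α (eps P.natDegree ^ m * x) ^ n)
      (∑ m ∈ Icc 1 P.natDegree, rescale (eps P.natDegree ^ m) (α ^ n)) :=
    Represents.sum _ fun m _ => (h.represents.pow n).rescale _
  have hr : Represents
      (fun x => ∑ j ∈ Icc 1 n, n * ((P ^ j).coeff n : ℂ) / j * x ^ (P.natDegree * j))
      (∑ j ∈ Icc 1 n, PowerSeries.monomial (P.natDegree * j) (n * ((P ^ j).coeff n : ℂ) / j)) :=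
    Represents.sum _ fun j _ => Represents.monomial _ _
  have he := congrArg (coeff (P.natDegree * j)) (hl.unique hr (h.sum_value_pow hP hn))
  simp only [map_sum, coeff_rescale, coeff_monomial, Nat.mul_right_inj hN] at he
  have h1 (m : ℕ) : (eps P.natDegree ^ m) ^ (P.natDegree * j) = 1 := by
    rw [← pow_mul, mul_left_comm, pow_mul, eps_pow_self hN, one_pow]
  simp only [h1, one_mul, sum_const, Nat.card_Icc, Nat.add_sub_cancel, nsmul_eq_mul] at he
  rw [he, sum_ite_eq]
  split_ifs with hj
  · rfl
  · rw [mem_Icc, not_and_or] at hj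
    rcases Nat.eq_zero_or_pos j with rfl | hj0
    · simp
    · have : (P ^ j).coeff n = 0 :=
        Polynomial.X_pow_dvd_iff.1 (pow_dvd_pow_of_dvd hP j) n (by omega)
      simp [this]

theorem sum_eps_pow {M : ℕ} (hM : M ≠ 0) (d : ℕ) :
    ∑ m ∈ Icc 1 M, (eps M ^ m) ^ d = if M ∣ d then (M : ℂ) else 0 := by
  have hprim : IsPrimitiveRoot (eps M) M := Complex.isPrimitiveRoot_exp M hM
  have h1 : ∑ m ∈ Icc 1 M, (eps M ^ m) ^ d = eps M ^ d * ∑ m ∈ range M, (eps M ^ d) ^ m := by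
    rw [mul_sum]
    symm
    refine sum_nbij' (· + 1) (· - 1) (fun j hj => ?_) (fun j hj => ?_) (fun j _ => rfl)
      (fun j hj => ?_) fun j _ => ?_
    · simp only [mem_range, mem_Icc] at *
      omega
    · simp only [mem_range, mem_Icc] at *
      omega
    · simp only [mem_Icc] at hj
      omega
    · ring
  rw [h1]
  split_ifs with h
  · have : eps M ^ d = 1 := (hprim.pow_eq_one_iff_dvd d).2 h
    simp [this]
  · have h2 : eps M ^ d ≠ 1 := fun h' => h ((hprim.pow_eq_one_iff_dvd d).1 h')
    rw [geom_sum_eq h2, ← pow_mul, mul_comm d M, pow_mul, eps_pow_self hM]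
    simp

/-! ### The logarithmic sums and the exponent -/

/-- The rational power series `∑_{m=1}^{NL} (Log (1 - α(ε_{NL}^m X)))^k`, where `N = deg P`,
expressed through the coefficients of the powers of `P`. -/
def ratLogSum (P : Polynomial ℚ) (L k : ℕ) : ℚ⟦X⟧ :=
  PowerSeries.mk fun d => if P.natDegree * L ∣ d then
    ∑ n ∈ range (d + 1), coeff n (log ℚ ^ k) * (-1) ^ n *
      (n * (P ^ (L * (d / (P.natDegree * L)))).coeff n / ((d / (P.natDegree * L) : ℕ) : ℚ)) else 0

theorem IsRootSeries.map_ratLogSum (h : IsRootSeries P α) (hP : Polynomial.X ∣ P)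
    (hN : P.natDegree ≠ 0) {L : ℕ} (hL : 1 ≤ L) {k : ℕ} (hk : 1 ≤ k) :
    PowerSeries.map (algebraMap ℚ ℂ) (ratLogSum P L k) = logSum α (P.natDegree * L) k := by
  have hM : P.natDegree * L ≠ 0 := Nat.mul_ne_zero hN (by omega)
  ext d
  have h0 (m : ℕ) : constantCoeff (rescale (eps (P.natDegree * L) ^ m) α) = 0 := by
    rw [← coeff_zero_eq_constantCoeff_apply, coeff_rescale, coeff_zero_eq_constantCoeff_apply,
      h.constantCoeff_eq, mul_zero]
  rw [logSum, map_sum, sum_congr rfl fun m _ => coeff_logOf_one_sub_pow _ (h0 m) k d, sum_comm]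
  simp only [← map_pow, coeff_rescale]
  simp only [← mul_sum, ← sum_mul, sum_eps_pow hM]
  rw [coeff_map, ratLogSum, coeff_mk]
  split_ifs with hd
  · obtain ⟨j, rfl⟩ := hd
    rw [Nat.mul_div_cancel_left _ (Nat.pos_of_ne_zero hM), map_sum]
    refine sum_congr rfl fun n _ => ?_
    rcases Nat.eq_zero_or_pos n with rfl | hn
    · rw [coeff_pow_eq_zero constantCoeff_log hk]
      simp
    · rw [map_mul, eq_ratCast]
      congr 1
      have := h.coeff_pow hP hN hn (L * j)
      rw [mul_assoc P.natDegree L j]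
      have hL' : (L : ℂ) ≠ 0 := by exact_mod_cast (show L ≠ 0 by omega)
      push_cast at this ⊢
      rw [mul_right_comm, this]
      simp only [eq_ratCast]
      rw [mul_div_mul_comm]
      field_simp
  · simp

/-- For `k = 1` the coefficient of `X^{NLj}` with `j ≥ 1` is `-P(1)^{Lj} / j`, which allows the
exponent to start at `k = 2`. -/
theorem coeff_one_ratLogSum (hP : Polynomial.X ∣ P) (h1 : P.eval 1 = 0) (hN : P.natDegree ≠ 0)
    {L : ℕ} (hL : 1 ≤ L) (d : ℕ) : coeff d (ratLogSum P L 1) = 0 := by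
  have hM : P.natDegree * L ≠ 0 := Nat.mul_ne_zero hN (by omega)
  rw [ratLogSum, coeff_mk]
  split_ifs with hd
  · obtain ⟨j, rfl⟩ := hd
    rw [Nat.mul_div_cancel_left _ (Nat.pos_of_ne_zero hM)]
    rcases Nat.eq_zero_or_pos j with rfl | hj
    · simp
    have hLj : L * j ≠ 0 := Nat.mul_ne_zero (by omega) hj.ne'
    -- The cutoff `n ≤ NLj` loses nothing: it is the degree of `P^{Lj}`.
    have hdeg : (P ^ (L * j)).natDegree < P.natDegree * L * j + 1 := by
      rw [Polynomial.natDegree_pow]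
      exact Nat.lt_succ_of_le (by nlinarith)
    have he : ∑ n ∈ range (P.natDegree * L * j + 1), (P ^ (L * j)).coeff n = 0 := by
      have := Polynomial.eval_eq_sum_range' hdeg 1
      simpa [h1, hLj] using this.symm
    rw [← mul_zero (-1 / (j : ℚ)), ← he, mul_sum]
    refine sum_congr rfl fun n _ => ?_
    rcases Nat.eq_zero_or_pos n with rfl | hn
    · rw [Polynomial.X_dvd_iff.1 (dvd_pow hP hLj)]
      simp
    · have hn' : (n : ℚ) ≠ 0 := by exact_mod_cast hn.ne'
      have hs : (-1 : ℚ) ^ n * (-1) ^ n = 1 := by rw [← mul_pow]; simp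
      rw [pow_one, coeff_log, if_neg hn.ne', pow_succ]
      simp only [eq_ratCast, Rat.cast_id]
      field_simp
      linear_combination (-(P ^ (L * j)).coeff n) * hs
  · rfl

/-- Interchanging the sums over `k` and `n`, the inversion of the Stirling sum leaves only `n = i`;
then `(i-1)! · i / i! = 1` leaves the coefficient of `z^i` in `P^{Lj} / j`. -/
theorem sum_ratLogSum_smul_phi (hP : Polynomial.X ∣ P) (hN : P.natDegree ≠ 0)
    {L : ℕ} (hL : 1 ≤ L) (j : ℕ) :
    ∑ k ∈ Icc 1 (P.natDegree * L * j),
        ratHbar (coeff (P.natDegree * L * j) (ratLogSum P L k) / k.factorial) (-(k : ℤ)) • phi k =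
      psi (Polynomial.C (1 / (j : ℚ)) * P ^ (L * j)) := by
  have hM : P.natDegree * L ≠ 0 := Nat.mul_ne_zero hN (by omega)
  rw [sum_smul_phi _ fun k => coeff (P.natDegree * L * j) (ratLogSum P L k)]
  congr 1
  set d := P.natDegree * L * j with hd
  have hc (k : ℕ) : coeff d (ratLogSum P L k) =
      ∑ n ∈ range (d + 1), coeff n (log ℚ ^ k) * (-1) ^ n *
        (n * (P ^ (L * j)).coeff n / (j : ℚ)) := by
    rw [ratLogSum, coeff_mk, if_pos (hd ▸ dvd_mul_right _ _), hd,
      Nat.mul_div_cancel_left _ (Nat.pos_of_ne_zero hM)]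
  have hinner (i : ℕ) (hi : i ∈ Icc 1 d) :
      ∑ k ∈ Icc 1 d, Nat.stirlingSecond k i * coeff d (ratLogSum P L k) / k.factorial =
        (-1) ^ i * (i * (P ^ (L * j)).coeff i / (j : ℚ)) / i.factorial := by
    rw [mem_Icc] at hi
    have hfi : (i.factorial : ℚ) ≠ 0 := by exact_mod_cast i.factorial_ne_zero
    have hsub : ∑ k ∈ Icc 1 d, Nat.stirlingSecond k i * coeff d (ratLogSum P L k) / k.factorial =
        ∑ k ∈ range (d + 1),
          Nat.stirlingSecond k i * coeff d (ratLogSum P L k) / k.factorial := by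
      refine sum_subset (fun k hk => ?_) fun k hk hk' => ?_
      · rw [mem_Icc] at hk
        rw [mem_range]
        omega
      · rw [mem_range] at hk
        rw [mem_Icc] at hk'
        obtain rfl : k = 0 := by omega
        rw [Nat.stirlingSecond_eq_zero_of_lt (by omega)]
        simp
    rw [hsub, eq_div_iff hfi, sum_mul]
    simp only [hc, mul_sum, sum_div, sum_mul]
    rw [sum_comm]
    have hn (n : ℕ) (hn : n ∈ range (d + 1)) :
        ∑ k ∈ range (d + 1), Nat.stirlingSecond k i * (coeff n (log ℚ ^ k) * (-1) ^ n *
          (n * (P ^ (L * j)).coeff n / (j : ℚ))) / k.factorial * i.factorial =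
        if n = i then (-1) ^ i * (i * (P ^ (L * j)).coeff i / (j : ℚ)) else 0 := by
      rw [mem_range, Nat.lt_succ_iff] at hn
      have h := sum_stirlingSecond_mul_coeff_log_pow i hn
      trans ((-1) ^ n * (n * (P ^ (L * j)).coeff n / (j : ℚ))) * if n = i then 1 else 0
      · rw [← h, mul_sum]
        refine sum_congr rfl fun k _ => ?_
        ring
      · split_ifs with hni
        · rw [hni, mul_one]
        · rw [mul_zero]
    rw [sum_congr rfl hn, sum_ite_eq', if_pos (mem_range.2 (by omega))]
  ext i
  rw [Polynomial.finsetSum_coeff]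
  simp only [Polynomial.coeff_monomial, Polynomial.coeff_C_mul, sum_ite_eq']
  split_ifs with hi
  · rw [hinner i hi]
    rw [mem_Icc] at hi
    obtain ⟨i, rfl⟩ := Nat.exists_eq_add_of_le' hi.1
    have hfi : (i.factorial : ℚ) ≠ 0 := by exact_mod_cast i.factorial_ne_zero
    have hi' : ((i + 1 : ℕ) : ℚ) ≠ 0 := by exact_mod_cast i.succ_ne_zero
    have hs : (-1 : ℚ) ^ (i + 1) * (-1) ^ (i + 1) = 1 := by rw [← mul_pow]; simp
    rcases Nat.eq_zero_or_pos j with rfl | hj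
    · simp
    have hj' : (j : ℚ) ≠ 0 := by exact_mod_cast hj.ne'
    rw [Nat.add_sub_cancel, Nat.factorial_succ]
    generalize (-1 : ℚ) ^ (i + 1) = e at hs
    push_cast at hi' ⊢
    field_simp
    linear_combination ((P ^ (L * j)).coeff (i + 1)) * hs
  · rw [mem_Icc, not_and_or] at hi
    rcases Nat.eq_zero_or_pos j with rfl | hj
    · simp
    have hLj : L * j ≠ 0 := Nat.mul_ne_zero (by omega) hj.ne'
    rcases Nat.eq_zero_or_pos i with rfl | hi0
    · rw [Polynomial.X_dvd_iff.1 (dvd_pow hP hLj), mul_zero]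
    · rw [Polynomial.coeff_eq_zero_of_natDegree_lt, mul_zero]
      rw [Polynomial.natDegree_pow, mul_comm, ← mul_assoc]
      omega

theorem exponent_ratLogSum (hP : Polynomial.X ∣ P) (h1 : P.eval 1 = 0) (hN : P.natDegree ≠ 0)
    {L : ℕ} (hL : 1 ≤ L) :
    exponent (ratLogSum P L) =
      letterSeries (circLogCoeff (circPow (psi P) L) (P.natDegree * L)) := by
  have hM : P.natDegree * L ≠ 0 := Nat.mul_ne_zero hN (by omega)
  ext d
  rw [coeff_letterSeries, exponent, coeff_mk]
  have h2 : ∑ k ∈ Icc 2 d, ratHbar (coeff d (ratLogSum P L k) / k.factorial) (-(k : ℤ)) •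
        Z.toH1 (phi k) =
      Z.toH1 (∑ k ∈ Icc 1 d, ratHbar (coeff d (ratLogSum P L k) / k.factorial) (-(k : ℤ)) •
        phi k) := by
    rw [map_sum]
    simp only [map_smul]
    refine sum_subset (Icc_subset_Icc_left one_le_two) fun k hk hk' => ?_
    rw [mem_Icc] at hk hk'
    obtain rfl : k = 1 := by omega
    rw [coeff_one_ratLogSum hP h1 hN hL, zero_div, ratHbar_zero, zero_smul]
  rw [h2]
  by_cases hd : P.natDegree * L ∣ d
  · obtain ⟨j, rfl⟩ := hd
    rw [sum_ratLogSum_smul_phi hP hN hL, circLogCoeff_psi P hP hL (by omega), map_neg]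
  · rw [circLogCoeff, if_neg hd, map_zero, sum_eq_zero, map_zero, neg_zero]
    intro k _
    rw [ratLogSum, coeff_mk, if_neg hd, zero_div, ratHbar_zero, zero_smul]

/-! ### Existence of `α` -/

/-- Both sides have degree at most `n` and agree at the `n + 1` points `0` and `1 / a m`. -/
theorem one_sub_eq_prod_of_forall_root (Q : Polynomial ℂ) (hQ0 : Q.eval 0 = 1) {n : ℕ}
    (hQ : Q.natDegree ≤ n) (a : ℕ → ℂ) (ha : ∀ m ∈ Icc 1 n, a m ≠ 0)
    (hinj : ∀ m ∈ Icc 1 n, ∀ m' ∈ Icc 1 n, a m = a m' → m = m')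
    (hroot : ∀ m ∈ Icc 1 n, Q.eval (a m)⁻¹ = 0) :
    Q = ∏ m ∈ Icc 1 n, (1 - Polynomial.C (a m) * Polynomial.X) := by
  rw [← sub_eq_zero]
  refine Polynomial.eq_zero_of_natDegree_lt_card_of_eval_eq_zero' _
    (insert 0 ((Icc 1 n).image fun m => (a m)⁻¹)) (fun z hz => ?_) ?_
  · rw [mem_insert, mem_image] at hz
    rw [Polynomial.eval_sub, Polynomial.eval_prod]
    rcases hz with rfl | ⟨m, hm, rfl⟩
    · simp [hQ0]
    · rw [hroot m hm, zero_sub, neg_eq_zero]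
      refine prod_eq_zero hm ?_
      simp [ha m hm]
  · rw [card_insert_of_notMem, card_image_of_injOn]
    · rw [Nat.card_Icc, Nat.add_sub_cancel, Nat.lt_succ_iff]
      refine (Polynomial.natDegree_sub_le _ _).trans (max_le hQ ?_)
      refine (Polynomial.natDegree_prod_le _ _).trans ((sum_le_card_nsmul _ _ 1 fun m _ => ?_).trans
        (by simp))
      compute_degree
    · intro m hm m' hm' h
      exact hinj m hm m' hm' (inv_injective h)
    · rw [mem_image]
      rintro ⟨m, hm, h⟩
      exact ha m hm (inv_eq_zero.1 h)

/-- Near `0`, the equation `w ^ N = x ^ N * q(w)` with `q(0) ≠ 0` has an analytic solution `w(x)`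
which is injective and vanishes only at `0`. -/
theorem exists_analytic_root (q : Polynomial ℂ) (hq : q.eval 0 ≠ 0) {N : ℕ} (hN : N ≠ 0) :
    ∃ (f r : ℂ → ℂ), AnalyticAt ℂ r 0 ∧ r 0 = 0 ∧ f 0 = 0 ∧
      (∀ᶠ x in nhds 0, f (r x) = x ∧ r x ^ N = x ^ N * q.eval (r x)) := by
  have hNC : (N : ℂ) ≠ 0 := by exact_mod_cast hN
  obtain ⟨c, hc⟩ := IsAlgClosed.exists_pow_nat_eq (q.eval 0)⁻¹ (Nat.pos_of_ne_zero hN)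
  have hc0 : c ≠ 0 := by
    rintro rfl
    rw [zero_pow hN] at hc
    exact inv_ne_zero hq hc.symm
  -- `h` is a branch of `q^{-1/N}`: dividing by `q(0)` moves the base near 1, away from the cut of
  -- the complex power, and `c` restores the constant. The local inverse `r` of `w h(w)` is the
  -- solution.
  set h : ℂ → ℂ := fun w => c * (q.eval w / q.eval 0) ^ (-(N : ℂ)⁻¹) with hdef
  set f : ℂ → ℂ := fun w => w * h w with hf
  have hqa : AnalyticAt ℂ (fun w => q.eval w) 0 := q.differentiable.analyticAt 0
  have hh : AnalyticAt ℂ h 0 := by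
    refine analyticAt_const.mul ((hqa.div analyticAt_const hq).cpow analyticAt_const ?_)
    simp [hq]
  have hfa : AnalyticAt ℂ f 0 := analyticAt_id.mul hh
  have h0 : h 0 = c := by simp [hdef, hq]
  have hderiv : deriv f 0 ≠ 0 := by
    have h1 : HasDerivAt f (1 * h 0 + 0 * deriv h 0) 0 :=
      (hasDerivAt_id (0 : ℂ)).mul hh.differentiableAt.hasDerivAt
    rw [h1.deriv, h0, one_mul, zero_mul, add_zero]
    exact hc0
  have hf0 : f 0 = 0 := by simp [hf]
  set r := hfa.hasStrictDerivAt.localInverse _ _ _ hderiv with hr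
  have hra : AnalyticAt ℂ r 0 := by
    have := hfa.analyticAt_localInverse hderiv
    rwa [hf0] at this
  have hr0 : r 0 = 0 := by
    have : r (f 0) = 0 := HasStrictFDerivAt.localInverse_apply_image ..
    rwa [hf0] at this
  have hfr : ∀ᶠ x in nhds 0, f (r x) = x := by
    have : ∀ᶠ x in nhds (f 0), f (r x) = x :=
      HasStrictDerivAt.eventually_right_inverse ..
    rwa [hf0] at this
  have hne : ∀ᶠ x in nhds 0, q.eval (r x) ≠ 0 := by
    have hcont : ContinuousAt (fun x => q.eval (r x)) 0 :=
      ContinuousAt.comp (g := fun w => q.eval w) q.continuous.continuousAt hra.continuousAt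
    exact hcont.eventually_ne (by simpa [hr0] using hq)
  refine ⟨f, r, hra, hr0, hf0, ?_⟩
  filter_upwards [hfr, hne] with x hx hxne
  refine ⟨hx, ?_⟩
  have hpow : h (r x) ^ N = (q.eval (r x))⁻¹ := by
    rw [hdef]
    simp only [mul_pow]
    rw [hc, ← Complex.cpow_mul_nat, neg_mul, inv_mul_cancel₀ hNC, Complex.cpow_neg_one]
    field_simp
  have hx' : x ^ N = (r x * h (r x)) ^ N := by rw [show r x * h (r x) = x from hx]
  rw [hx', mul_pow, hpow]
  field_simp

theorem exists_isRootSeries (hP : Polynomial.X ∣ P) (hP0 : P ≠ 0) (hN : P.natDegree ≠ 0) :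
    ∃ α : ℂ⟦X⟧, IsRootSeries P α := by
  set PC : Polynomial ℂ := P.map (algebraMap ℚ ℂ) with hPC
  have hdeg : PC.natDegree = P.natDegree := Polynomial.natDegree_map _
  have hPC0 : PC ≠ 0 := (Polynomial.map_ne_zero_iff (algebraMap ℚ ℂ).injective).2 hP0
  -- The reversed polynomial is `w^N P(1/w)`, so `w^N = x^N q(w)` with `w ≠ 0` says that `1/w` is a
  -- root of `1 - x^N P`.
  have hq : PC.reverse.eval 0 ≠ 0 := by
    rw [← Polynomial.coeff_zero_eq_eval_zero, Polynomial.coeff_zero_reverse]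
    exact Polynomial.leadingCoeff_ne_zero.2 hPC0
  obtain ⟨f, r, hra, hr0, hf0, hfr⟩ := exists_analytic_root PC.reverse hq hN
  obtain ⟨p, hp⟩ := hra
  set α : ℂ⟦X⟧ := PowerSeries.mk p.coeff with hα
  have hrep : Represents r α := by
    rw [hasFPowerSeriesAt_iff] at hp
    filter_upwards [hp] with x hx
    rw [zero_add] at hx
    simpa [hα, mul_comm] using hx
  have hval : ∀ᶠ x in nhds (0 : ℂ), value α x = r x := by
    filter_upwards [hrep] with x hx using hx.tsum_eq
  have heps : eps P.natDegree ≠ 0 := Complex.exp_ne_zero _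
  have hprim : IsPrimitiveRoot (eps P.natDegree) P.natDegree :=
    Complex.isPrimitiveRoot_exp _ hN
  refine ⟨α, ?_, ?_, ?_⟩
  · rw [← coeff_zero_eq_constantCoeff_apply, hα, coeff_mk, ← hr0]
    exact hp.coeff_zero _
  · exact hrep.hasFPowerSeriesAt.radius_pos
  have hall : ∀ᶠ x in nhds (0 : ℂ), ∀ m ∈ Icc 1 P.natDegree,
      value α (eps P.natDegree ^ m * x) = r (eps P.natDegree ^ m * x) ∧
      f (r (eps P.natDegree ^ m * x)) = eps P.natDegree ^ m * x ∧
      r (eps P.natDegree ^ m * x) ^ P.natDegree = (eps P.natDegree ^ m * x) ^ P.natDegree *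
        PC.reverse.eval (r (eps P.natDegree ^ m * x)) := by
    refine (Filter.eventually_all_finset _).2 fun m _ => ?_
    have hc : Filter.Tendsto (fun x : ℂ => eps P.natDegree ^ m * x) (nhds 0) (nhds 0) := by
      have : Continuous fun x : ℂ => eps P.natDegree ^ m * x := by fun_prop
      simpa using this.tendsto 0
    exact hc.eventually (hval.and hfr)
  filter_upwards [hall] with x hx z
  -- At `x = 0` all the values of `α` are 0, and the interpolation argument, which needs distinct
  -- nonzero values, does not apply.
  rcases eq_or_ne x 0 with rfl | hx0
  · have h00 : value α 0 = 0 := by simpa [hr0] using hval.self_of_nhds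
    simp [h00, hN]
  have hx0' (m : ℕ) : eps P.natDegree ^ m * x ≠ 0 := mul_ne_zero (pow_ne_zero _ heps) hx0
  have hrne (m : ℕ) (hm : m ∈ Icc 1 P.natDegree) : value α (eps P.natDegree ^ m * x) ≠ 0 := by
    obtain ⟨h1, h2, -⟩ := hx m hm
    rw [h1]
    intro h
    rw [h, hf0] at h2
    exact hx0' m h2.symm
  have hprod := one_sub_eq_prod_of_forall_root
    (1 - Polynomial.C (x ^ P.natDegree) * PC) ?_ (n := P.natDegree) ?_
    (fun m => value α (eps P.natDegree ^ m * x)) hrne ?_ ?_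
  · have := congrArg (Polynomial.eval z) hprod
    simpa only [Polynomial.eval_prod, Polynomial.eval_sub, Polynomial.eval_mul,
      Polynomial.eval_one, Polynomial.eval_C, Polynomial.eval_X, hPC,
      Polynomial.eval_map_algebraMap] using this
  · have h0 : P.coeff 0 = 0 := Polynomial.X_dvd_iff.1 hP
    rw [← Polynomial.coeff_zero_eq_eval_zero, Polynomial.coeff_sub, Polynomial.coeff_C_mul, hPC,
      Polynomial.coeff_map, h0]
    simp
  · refine (Polynomial.natDegree_sub_le _ _).trans (max_le (by simp) ?_)
    exact (Polynomial.natDegree_C_mul_le _ _).trans hdeg.le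
  -- Applying `f` recovers `ε^m x` from the value, so equal values force `m ≡ m'` modulo `N`, with
  -- both in `1, …, N`.
  · intro m hm m' hm' h
    obtain ⟨h1, h2, -⟩ := hx m hm
    obtain ⟨h1', h2', -⟩ := hx m' hm'
    simp only [h1, h1'] at h
    rw [h, h2'] at h2
    have h3 := mul_right_cancel₀ hx0 h2
    rw [mem_Icc] at hm hm'
    have h4 := (hprim.isOfFinOrder hN).pow_eq_pow_iff_modEq.1 h3
    rw [← hprim.eq_orderOf] at h4
    have h5 := Int.eq_zero_of_abs_lt_dvd h4.dvd (abs_lt.2 ⟨by omega, by omega⟩)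
    omega
  · intro m hm
    obtain ⟨h1, h2, h3⟩ := hx m hm
    have hw := hrne m hm
    simp only [h1] at hw ⊢
    generalize r (eps P.natDegree ^ m * x) = w at *
    have h5 : (eps P.natDegree ^ m * x) ^ P.natDegree = x ^ P.natDegree := by
      rw [mul_pow, ← pow_mul, mul_comm m, pow_mul, eps_pow_self hN, one_pow, one_mul]
    rw [h5] at h3
    let _ : Invertible w⁻¹ := invertibleOfNonzero (inv_ne_zero hw)
    have h6 := Polynomial.eval₂_reverse_mul_pow (RingHom.id ℂ) w⁻¹ PC
    rw [invOf_eq_inv, inv_inv, hdeg] at h6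
    change Polynomial.eval w PC.reverse * _ = Polynomial.eval w⁻¹ PC at h6
    rw [Polynomial.eval_sub, Polynomial.eval_one, Polynomial.eval_mul, Polynomial.eval_C, ← h6,
      ← mul_assoc, ← h3, ← mul_pow, mul_inv_cancel₀ hw, one_pow, sub_self]

theorem two_le_natDegree (P : Polynomial ℚ) (hP : P ≠ 0) (h0 : P.eval 0 = 0) (h1 : P.eval 1 = 0) :
    2 ≤ P.natDegree := by
  have hle : ({0, 1} : Finset ℚ).card ≤ P.natDegree := by
    by_contra! hlt
    refine hP (Polynomial.eq_zero_of_natDegree_lt_card_of_eval_eq_zero' P {0, 1} ?_ hlt)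
    simp [h0, h1]
  simpa using hle

end QMZV

end

/-! ### The theorem -/

open PowerSeries in
theorem theorem3p1 (P : Polynomial ℚ) (hP : P ≠ 0) (h0 : P.eval 0 = 0) (h1 : P.eval 1 = 0)
    (L : ℕ) (hL : 1 ≤ L) :
    2 ≤ P.natDegree ∧
    (∃ α : ℂ⟦X⟧, QMZV.IsRootSeries P α) ∧
    ∀ α : ℂ⟦X⟧, QMZV.IsRootSeries P α →
      ∃ S : ℕ → ℚ⟦X⟧,
        (∀ k : ℕ, 2 ≤ k →
          PowerSeries.map (algebraMap ℚ ℂ) (S k) = QMZV.logSum α (P.natDegree * L) k) ∧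
        (∀ n : ℕ, coeff n (QMZV.geom (QMZV.circPow (QMZV.psi P) L) (P.natDegree * L)) ∈ QMZV.H0) ∧
        (∀ n : ℕ, coeff n (QMZV.exponent S) ∈ QMZV.H0) ∧
        QMZV.geom (QMZV.circPow (QMZV.psi P) L) (P.natDegree * L) =
          QMZV.expHarm (QMZV.exponent S) := by
  have h2 := QMZV.two_le_natDegree P hP h0 h1
  have hN : P.natDegree ≠ 0 := by omega
  have hM : 1 ≤ P.natDegree * L := Nat.mul_pos (by omega) hL
  have hX : Polynomial.X ∣ P := by
    rwa [Polynomial.X_dvd_iff, Polynomial.coeff_zero_eq_eval_zero]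
  refine ⟨h2, QMZV.exists_isRootSeries hX hP hN, fun α hα => ⟨QMZV.ratLogSum P L, fun k hk =>
    hα.map_ratLogSum hX hN hL (by omega), QMZV.coeff_geom_psi_mem_H0 P hX hL hM,
    QMZV.coeff_exponent_mem_H0 _, ?_⟩⟩
  rw [QMZV.exponent_ratLogSum hX h1 hN hL]
  exact QMZV.geom_eq_expHarm _ _ hM
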